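/- **Conventions.** Let $1\le k\le n-1$. For $x\in\mathbb R^n$ and $J\subseteq\{1,\dots,n\}$ put $x_J=\sum_{j\in J}x_j$ and $e_J=\sum_{j\in J}e_j$, let $\mathcal H_{k,n}=\{x\in\mathbb R^n: x_1+\dots+x_n=k\}$, and let $\Delta_{k,n}=[0,1]^n\cap\mathcal H_{k,n}$ be the hypersimplex. A *decorated ordered set partition* of $(\{1,\dots,n\},k)$ is an ordered partition $(S_1,\dots,S_\ell)$ of $\{1,\dots,n\}$ into nonempty blocks with integers $s_1,\dots,s_\ell$ of sum $k$; it is *of type* $\Delta_{k,n}$ if $1\le s_j\le |S_j|-1$ for all $j$. Its *plate* $[(S_1)_{s_1},\dots,(S_\ell)_{s_\ell}]$ is the set of $x\in\mathcal H_{k,n}$ with $x_{S_1\cup\dots\cup S_m}\ge s_1+\dots+s_m$ for $m=1,\dots,\ell-1$, and its *blade* $(((S_1)_{s_1},\dots,(S_\ell)_{s_\ell}))$ is the union of the boundaries in $\mathcal H_{k,n}$ (i.e. of the facets) of the plates of its $\ell$ cyclic block rotations. For a cyclic order $\sigma=(\sigma_1,\dots,\sigma_n)$ of $\{1,\dots,n\}$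 (e.g. $(1,2,\dots,n)$) let $((\sigma_1,\dots,\sigma_n))$ be the blade with singleton blocks $\{\sigma_i\}$ and all decorations $0$, and let $((\sigma_1,\dots,\sigma_n))_p$ be its translate by $p\in\mathbb R^n$. A polytopal subdivision of a polytope $P$ is given by its set of maximal cells: finitely many polytopes of dimension $\dim P$ covering $P$, any two meeting in a common face. A subdivision of $P$ with $d\ge1$ maximal cells $P_1,\dots,P_d$ is a *$d$-split* if it is coarsest (the only subdivisions that it refines are itself and the trivial one $\{P\}$), any two of the $P_i$ meet in a common facet, and $P_1\cap\dots\cap P_d$ is nonempty of codimension $d-1$. It is a *matroid subdivision* if each maximal cell is the convex hull of the vectors $e_B$, $B$ running over the bases of some matroid on $\{1,\dots,n\}$. A blade *induces* on $\Delta_{k,n}$ the subdivision whose maximal cells are the closures of the connected components of the relative interior of $\Delta_{k,n}$ minus the blade. **Theorem.** Let $I\subset\{1,\dots,n\}$ with $|I|=k$, so that $e_I$ is a vertex of $\Delta_{k,n}$, and fix a cyclic order $\sigma=(\sigma_1,\dots,\sigma_n)$. Up to cyclic rotation, $(\sigma_1,\dots,\sigma_n)$ can be written as a concatenation $(C_1,I_1,C_2,I_2,\dots,C_\ell,I_\ell)$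 of nonempty runs of consecutive elements with $I_j\subseteq I$ and $C_j\cap I=\emptyset$. For each such decomposition put $S_j=I_j\cup C_j$ and $s_j=|I_j|$. Then: 1. $\ell$ is the number of (maximal) cyclic intervals in $I$, and $((S_1)_{s_1},\dots,(S_\ell)_{s_\ell})$ is a decorated ordered set partition of type $\Delta_{k,n}$. 2. The translated blade $((\sigma_1,\dots,\sigma_n))_{e_I}$ and the blade $(((S_1)_{s_1},\dots,(S_\ell)_{s_\ell}))$ have the same intersection with the relative interior of $\Delta_{k,n}$; on all of $\Delta_{k,n}$ one has the inclusion $(((S_1)_{s_1},\dots,(S_\ell)_{s_\ell}))\cap\Delta_{k,n}\subseteq ((\sigma_1,\dots,\sigma_n))_{e_I}\cap\Delta_{k,n}$. 3. The translated blade $((\sigma_1,\dots,\sigma_n))_{e_I}$ induces an $\ell$-split of $\Delta_{k,n}$ (in particular with $\ell$ maximal cells) that is a matroid subdivision. 4. This subdivision is trivial, i.e. equal to $\{\Delta_{k,n}\}$, if and only if $I$ is a cyclic interval for $\sigma$. -/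

import Mathlib

open Set

noncomputable section

/-! ### Hypersimplices -/

/-- The coordinate sum `x_J = ∑_{j ∈ J} x_j`. -/
def coordSum {n : ℕ} (x : Fin n → ℝ) (J : Finset (Fin n)) : ℝ := ∑ j ∈ J, x j

/-- The vector `e_J = ∑_{j ∈ J} e_j`. -/
def eVec {n : ℕ} (J : Finset (Fin n)) : Fin n → ℝ := ∑ j ∈ J, Pi.single j 1

/-- The affine hyperplane `H_{k,n}` of `ℝⁿ` on which the coordinates sum to `k`. -/
def hyperplaneH (n : ℕ) (k : ℤ) : Set (Fin n → ℝ) := {x | ∑ i, x i = (k : ℝ)}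

/-- The hypersimplex `Δ_{k,n}`. -/
def hypersimplex (k n : ℕ) : Set (Fin n → ℝ) :=
  {x | (∀ i, x i ∈ Icc (0 : ℝ) 1) ∧ ∑ i, x i = (k : ℝ)}

/-! ### Decorated ordered set partitions, plates and blades -/

/-- `((S_1)_{s_1}, …, (S_ℓ)_{s_ℓ})` is a decorated ordered set partition of `({1,…,n}, k)`. -/
structure IsDecoratedOSP {n ℓ : ℕ} (k : ℤ) (S : Fin ℓ → Finset (Fin n)) (s : Fin ℓ → ℤ) :
    Prop where
  nonempty : ∀ j, (S j).Nonempty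
  disjoint : ∀ i j, i ≠ j → Disjoint (S i) (S j)
  cover : ∀ x, ∃ j, x ∈ S j
  sum_eq : ∑ j, s j = k

/-- The decorated ordered set partition is of type `Δ_{k,n}`: moreover `1 ≤ s_j ≤ |S_j| - 1`. -/
structure IsHypersimplicialOSP {n ℓ : ℕ} (k : ℤ) (S : Fin ℓ → Finset (Fin n))
    (s : Fin ℓ → ℤ) : Prop extends IsDecoratedOSP k S s where
  one_le : ∀ j, 1 ≤ s j
  le_card_sub_one : ∀ j, s j ≤ ((S j).card : ℤ) - 1

/-- The plate `[(S_1)_{s_1}, …, (S_ℓ)_{s_ℓ}]`: the cone in `H_{k,n}` cut out by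
`x_{S_1 ∪ ⋯ ∪ S_m} ≥ s_1 + ⋯ + s_m` for `m = 1, …, ℓ - 1`.  (Blocks are indexed from `0`, so
`Finset.Iio m` indexes the first `m` blocks; the case `m = 0` reads `0 ≤ 0`.) -/
def plate {n ℓ : ℕ} (k : ℤ) (S : Fin ℓ → Finset (Fin n)) (s : Fin ℓ → ℤ) : Set (Fin n → ℝ) :=
  {x | x ∈ hyperplaneH n k ∧
    ∀ m : Fin ℓ, ((∑ i ∈ Finset.Iio m, s i : ℤ) : ℝ) ≤ coordSum x ((Finset.Iio m).biUnion S)}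

/-- The boundary of a plate in `H_{k,n}`: the union of its facets, that is, the points of the
plate at which one of the `ℓ - 1` facet inequalities is an equality. -/
def plateBoundary {n ℓ : ℕ} (k : ℤ) (S : Fin ℓ → Finset (Fin n)) (s : Fin ℓ → ℤ) :
    Set (Fin n → ℝ) :=
  {x | x ∈ plate k S s ∧ ∃ m : Fin ℓ, 0 < (m : ℕ) ∧
    coordSum x ((Finset.Iio m).biUnion S) = ((∑ i ∈ Finset.Iio m, s i : ℤ) : ℝ)}

/-- The blade `(((S_1)_{s_1}, …, (S_ℓ)_{s_ℓ}))`: the union of the boundaries of the `ℓ` cyclic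
block rotations of the plate (addition in `Fin ℓ` is modulo `ℓ`). -/
def blade {n ℓ : ℕ} (k : ℤ) (S : Fin ℓ → Finset (Fin n)) (s : Fin ℓ → ℤ) : Set (Fin n → ℝ) :=
  ⋃ j : Fin ℓ, plateBoundary k (fun i => S (j + i)) (fun i => s (j + i))

/-- The blade `((σ_1, σ_2, …, σ_n))` in `H_{0,n}` of a cyclic order: all blocks are singletons and
all decorations are `0`. -/
def cyclicBlade {n : ℕ} (σ : Equiv.Perm (Fin n)) : Set (Fin n → ℝ) :=
  blade 0 (fun i : Fin n => {σ i}) (fun _ => 0)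

/-- The translate `((σ_1, …, σ_n))_p`. -/
def translatedBlade {n : ℕ} (σ : Equiv.Perm (Fin n)) (p : Fin n → ℝ) : Set (Fin n → ℝ) :=
  (fun x => p + x) '' cyclicBlade σ

/-! ### Cyclic intervals -/

/-- The elements `σ_t` for `a ≤ t < b`, where positions are read modulo `n`. -/
def arc {n : ℕ} [NeZero n] (σ : Equiv.Perm (Fin n)) (a b : ℕ) : Finset (Fin n) :=
  (Finset.Ico a b).image fun t => σ (Fin.ofNat n t)

/-- `J` is a (nonempty) cyclic interval for the cyclic order `(σ_1, …, σ_n)`. -/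
def IsCyclicInterval {n : ℕ} [NeZero n] (σ : Equiv.Perm (Fin n)) (J : Finset (Fin n)) : Prop :=
  ∃ a b : ℕ, a < b ∧ b ≤ a + n ∧ J = arc σ a b

/-- The number of cyclic intervals in `I`, that is, of maximal cyclic intervals contained
in `I`. -/
def numCyclicIntervals {n : ℕ} [NeZero n] (σ : Equiv.Perm (Fin n)) (I : Finset (Fin n)) : ℕ :=
  {J : Finset (Fin n) | Maximal (fun J => IsCyclicInterval σ J ∧ J ⊆ I) J}.ncard

/-- A decomposition of the cyclic order `(σ_1, …, σ_n)`, started at a suitable position, as a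
concatenation `(C_1, I_1, C_2, I_2, …, C_ℓ, I_ℓ)` of nonempty runs of consecutive elements,
where the `I_j` lie in `I` and the `C_j` in its complement.  The run `C_j` occupies the positions
`a_j ≤ t < b_j` and the run `I_j` the positions `b_j ≤ t < a_{j+1}`. -/
structure CyclicDecomposition {n : ℕ} [NeZero n] (σ : Equiv.Perm (Fin n)) (I : Finset (Fin n))
    (ℓ : ℕ) where
  a : Fin (ℓ + 1) → ℕ
  b : Fin ℓ → ℕ
  a_lt_b : ∀ j, a j.castSucc < b j
  b_lt_a : ∀ j, b j < a j.succ
  a_last : a (Fin.last ℓ) = a 0 + n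
  compl_run : ∀ j, Disjoint (arc σ (a j.castSucc) (b j)) I
  run : ∀ j, arc σ (b j) (a j.succ) ⊆ I

/-- The run `C_j` of elements outside `I`. -/
def CyclicDecomposition.C {n : ℕ} [NeZero n] {σ : Equiv.Perm (Fin n)} {I : Finset (Fin n)}
    {ℓ : ℕ} (D : CyclicDecomposition σ I ℓ) (j : Fin ℓ) : Finset (Fin n) :=
  arc σ (D.a j.castSucc) (D.b j)

/-- The cyclic interval `I_j` of `I` that follows `C_j`. -/
def CyclicDecomposition.I' {n : ℕ} [NeZero n] {σ : Equiv.Perm (Fin n)} {I : Finset (Fin n)}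
    {ℓ : ℕ} (D : CyclicDecomposition σ I ℓ) (j : Fin ℓ) : Finset (Fin n) :=
  arc σ (D.b j) (D.a j.succ)

/-- The block `S_j = I_j ∪ C_j`. -/
def CyclicDecomposition.S {n : ℕ} [NeZero n] {σ : Equiv.Perm (Fin n)} {I : Finset (Fin n)}
    {ℓ : ℕ} (D : CyclicDecomposition σ I ℓ) (j : Fin ℓ) : Finset (Fin n) :=
  D.I' j ∪ D.C j

/-- The decoration `s_j = |I_j|`. -/
def CyclicDecomposition.s {n : ℕ} [NeZero n] {σ : Equiv.Perm (Fin n)} {I : Finset (Fin n)}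
    {ℓ : ℕ} (D : CyclicDecomposition σ I ℓ) (j : Fin ℓ) : ℤ :=
  ((D.I' j).card : ℤ)

/-! ### Polytopal subdivisions, multi-splits, matroid polytopes -/

/-- `Q` is a polytope: the convex hull of finitely many points. -/
def IsPolytope {n : ℕ} (Q : Set (Fin n → ℝ)) : Prop :=
  ∃ V : Set (Fin n → ℝ), V.Finite ∧ Q = convexHull ℝ V

/-- The dimension of a nonempty convex set. -/
def polyDim {n : ℕ} (Q : Set (Fin n → ℝ)) : ℕ := Module.finrank ℝ (vectorSpan ℝ Q)

/-- `F` is a (possibly empty) face of the polytope `Q`. -/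
def IsFaceOf {n : ℕ} (F Q : Set (Fin n → ℝ)) : Prop := IsExposed ℝ Q F

/-- `𝒮` is the set of maximal cells of a polytopal subdivision of `P`: finitely many polytopes of
the same dimension as `P` that cover `P` and any two of which meet in a common face. -/
structure IsSubdivision {n : ℕ} (P : Set (Fin n → ℝ)) (𝒮 : Set (Set (Fin n → ℝ))) : Prop where
  finite : 𝒮.Finite
  polytope : ∀ Q ∈ 𝒮, IsPolytope Q
  nonempty : ∀ Q ∈ 𝒮, Q.Nonempty
  dim_eq : ∀ Q ∈ 𝒮, polyDim Q = polyDim P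
  cover : ⋃₀ 𝒮 = P
  face_inter : ∀ Q ∈ 𝒮, ∀ R ∈ 𝒮, IsFaceOf (Q ∩ R) Q ∧ IsFaceOf (Q ∩ R) R

/-- The subdivision `𝒮` of `P` is coarsest: the only subdivisions that it refines are itself and
the trivial one. -/
def IsCoarsest {n : ℕ} (P : Set (Fin n → ℝ)) (𝒮 : Set (Set (Fin n → ℝ))) : Prop :=
  ∀ 𝒯 : Set (Set (Fin n → ℝ)), IsSubdivision P 𝒯 → (∀ Q ∈ 𝒮, ∃ R ∈ 𝒯, Q ⊆ R) →
    𝒯 = 𝒮 ∨ 𝒯 = {P}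

/-- `𝒮` is a `d`-split of `P`: a coarsest subdivision of `P` into `d` maximal cells, any two of
which meet in a common facet, and whose common intersection has codimension `d - 1`. -/
structure IsSplit {n : ℕ} (d : ℕ) (P : Set (Fin n → ℝ)) (𝒮 : Set (Set (Fin n → ℝ))) :
    Prop where
  one_le : 1 ≤ d
  subdivision : IsSubdivision P 𝒮
  coarsest : IsCoarsest P 𝒮
  ncard_eq : 𝒮.ncard = d
  facet_inter : ∀ Q ∈ 𝒮, ∀ R ∈ 𝒮, Q ≠ R → (Q ∩ R).Nonempty ∧ polyDim (Q ∩ R) + 1 = polyDim P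
  inter_nonempty : (⋂₀ 𝒮).Nonempty
  codim_inter : polyDim (⋂₀ 𝒮) + (d - 1) = polyDim P

/-- `Q` is a matroid polytope: the convex hull of the vectors `e_B`, for `B` the bases of a
matroid on `{1, …, n}`. -/
def IsMatroidPolytope {n : ℕ} (Q : Set (Fin n → ℝ)) : Prop :=
  ∃ M : Matroid (Fin n), M.E = Set.univ ∧
    Q = convexHull ℝ {v | ∃ B : Finset (Fin n), M.IsBase (B : Set (Fin n)) ∧ v = eVec B}

/-- The maximal cells of the decomposition of `P` that is induced by `𝓑`: the closures of the
chambers, that is, of the connected components of what is left of the relative interior of `P`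
after removing `𝓑`. -/
def inducedCells {n : ℕ} (P 𝓑 : Set (Fin n → ℝ)) : Set (Set (Fin n → ℝ)) :=
  {Q | ∃ x ∈ intrinsicInterior ℝ P \ 𝓑,
    Q = closure (connectedComponentIn (intrinsicInterior ℝ P \ 𝓑) x)}

end

/-! ### Polytopes cut out of a hypersimplex by a chain of rank inequalities -/

/-! Everything is governed by the heights h_j(x) = ∑_{i<j} (x_{S_i} - s_i), one per block, which are
cyclic since the total excess vanishes on the hyperplane. The inequalities of the plate rotated to
start at block j say h_j ≤ h_m for all m, so the blade is the locus where the minimal height is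
attained at least twice (`IsDecoratedOSP.mem_blade_iff`), and off the blade the hypersimplex splits
according to which height is the unique minimum. These chambers are convex and relatively open,
hence are the connected components, and their closures are the cells.

For a partition of hypersimplicial type, the conditions 1 ≤ s_j ≤ |S_j| - 1 leave room inside the
open hypersimplex to prescribe the heights freely, up to a common constant, as long as they are
small (`IsHypersimplicialOSP.exists_height_eq`). This supplies the witnesses for nonempty chambers,
for the dimensions of all the intersections that a split involves, and for coarsestness: a convex
union of cells that contains two of them contains every other one
(`IsHypersimplicialOSP.cell_subset_of_convex`).

A cell is cut out of the hypersimplex by inequalities x_T ≥ r with integral r and T running over a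
chain of sets. A fractional coordinate can be traded against another one that the tight sets do not
separate from it, so the vertices are 0/1 vectors; a chain also gives basis exchange, so every cell
is a matroid polytope.

For the translated blade, the heights are the partial sums of x - e_I along σ. This walk moves up on
the runs C_j and down on the runs I_j, so its local minima sit at the starts of the C_j, where its
values are the block heights up to a constant. In the open hypersimplex the moves are strict and
every minimum is of this kind, so the two blades agree there; on the boundary further minima may
appear, which leaves only an inclusion. -/

lemma coordSum_add {n : ℕ} (x y : Fin n → ℝ) (J : Finset (Fin n)) :
    coordSum (x + y) J = coordSum x J + coordSum y J := by
  simp [coordSum, Finset.sum_add_distrib]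

lemma coordSum_smul {n : ℕ} (c : ℝ) (x : Fin n → ℝ) (J : Finset (Fin n)) :
    coordSum (c • x) J = c * coordSum x J := by
  simp [coordSum, Finset.mul_sum]

lemma coordSum_sub {n : ℕ} (x y : Fin n → ℝ) (J : Finset (Fin n)) :
    coordSum (x - y) J = coordSum x J - coordSum y J := by
  simp [coordSum, Finset.sum_sub_distrib]

lemma continuous_coordSum {n : ℕ} (J : Finset (Fin n)) :
    Continuous fun x : Fin n → ℝ => coordSum x J := by
  unfold coordSum; fun_prop

lemma eVec_apply {n : ℕ} (B : Finset (Fin n)) (i : Fin n) :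
    eVec B i = if i ∈ B then 1 else 0 := by
  simp [eVec, Finset.sum_apply, Pi.single_apply]

lemma coordSum_eVec {n : ℕ} (B J : Finset (Fin n)) :
    coordSum (eVec B) J = ((B ∩ J).card : ℝ) := by
  simp [coordSum, eVec_apply, Finset.sum_ite_mem, Finset.inter_comm]

lemma sum_eVec {n : ℕ} (B : Finset (Fin n)) : ∑ i, eVec B i = (B.card : ℝ) := by
  simp [eVec_apply]

lemma convex_hypersimplex (k n : ℕ) : Convex ℝ (hypersimplex k n) := by
  intro x hx y hy a b ha hb hab
  refine ⟨fun i => convex_Icc (0 : ℝ) 1 (hx.1 i) (hy.1 i) ha hb hab, ?_⟩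
  simp only [Pi.add_apply, Pi.smul_apply, smul_eq_mul, Finset.sum_add_distrib, ← Finset.mul_sum,
    hx.2, hy.2, ← add_mul, hab, one_mul]

lemma isClosed_hypersimplex (k n : ℕ) : IsClosed (hypersimplex k n) := by
  refine IsClosed.inter (s₁ := {x : Fin n → ℝ | ∀ i, x i ∈ Icc (0 : ℝ) 1})
    (s₂ := {x : Fin n → ℝ | ∑ i, x i = (k : ℝ)}) ?_ (isClosed_eq (by fun_prop) continuous_const)
  simp only [ofPred_forall]
  exact isClosed_iInter fun i => isClosed_Icc.preimage (continuous_apply i)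

lemma isCompact_hypersimplex (k n : ℕ) : IsCompact (hypersimplex k n) := by
  refine (isCompact_univ_pi fun _ : Fin n => isCompact_Icc (a := (0 : ℝ)) (b := 1)).of_isClosed_subset
    (isClosed_hypersimplex k n) fun x hx i _ => hx.1 i

/-- The points of the hypersimplex that satisfy `x_{T_i} ≥ r_i` for all `i`. -/
def rankPolytope {n : ℕ} {ι : Type*} (k : ℕ) (T : ι → Finset (Fin n)) (r : ι → ℤ) :
    Set (Fin n → ℝ) :=
  hypersimplex k n ∩ {x | ∀ i, (r i : ℝ) ≤ coordSum x (T i)}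

section rankPolytope

variable {n k : ℕ} {ι : Type*} {T : ι → Finset (Fin n)} {r : ι → ℤ}

lemma convex_rankPolytope : Convex ℝ (rankPolytope k T r) := by
  refine (convex_hypersimplex k n).inter ?_
  intro x hx y hy a b ha hb hab i
  have h1 := mul_le_mul_of_nonneg_left (hx i) ha
  have h2 := mul_le_mul_of_nonneg_left (hy i) hb
  rw [coordSum_add, coordSum_smul, coordSum_smul]
  calc (r i : ℝ) = a * r i + b * r i := by rw [← add_mul, hab, one_mul]
    _ ≤ _ := by gcongr

lemma isCompact_rankPolytope : IsCompact (rankPolytope k T r) := by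
  refine (isCompact_hypersimplex k n).inter_right ?_
  simp only [ofPred_forall]
  exact isClosed_iInter fun i => isClosed_le continuous_const (continuous_coordSum _)

lemma eVec_mem_rankPolytope {B : Finset (Fin n)} :
    eVec B ∈ rankPolytope k T r ↔ B.card = k ∧ ∀ i, r i ≤ ((B ∩ T i).card : ℤ) := by
  constructor
  · rintro ⟨h1, h2⟩
    refine ⟨by have := h1.2; rw [sum_eVec] at this; exact_mod_cast this, fun i => ?_⟩
    have := h2 i
    rw [coordSum_eVec] at this
    exact_mod_cast this
  · rintro ⟨h1, h2⟩
    refine ⟨⟨fun i => ?_, by rw [sum_eVec, h1]⟩, fun i => ?_⟩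
    · rw [eVec_apply]; split_ifs <;> simp
    · rw [coordSum_eVec]; exact_mod_cast h2 i

lemma eq_eVec_of_zero_or_one {x : Fin n → ℝ} (h : ∀ i, x i = 0 ∨ x i = 1) :
    x = eVec (Finset.univ.filter fun i => x i = 1) := by
  funext i
  rw [eVec_apply]
  rcases h i with h | h <;> simp [h]

/-- Such a point is the midpoint of x ± (δ/2)w for small δ. -/
lemma notMem_extremePoints_of_direction {P : Set (Fin n → ℝ)} {x w : Fin n → ℝ} (hw : w ≠ 0)
    (h : ∀ᶠ ε : ℝ in nhds 0, x + ε • w ∈ P) : x ∉ P.extremePoints ℝ := by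
  intro hx
  obtain ⟨δ, hδ, hδP⟩ := Metric.eventually_nhds_iff.1 h
  have h1 := hδP (y := δ / 2) (by simp [abs_of_pos hδ]; linarith)
  have h2 := hδP (y := -(δ / 2)) (by simp [abs_of_pos hδ]; linarith)
  have := (mem_extremePoints.1 hx).2 _ h1 _ h2
    ⟨1 / 2, 1 / 2, by norm_num, by norm_num, by norm_num, by ext i; simp; ring⟩
  have h3 : (δ / 2) • w = 0 := by simpa using this.1
  rcases smul_eq_zero.1 h3 with h3 | h3
  · linarith
  · exact hw h3

/-- In a chain of sets containing `∅` and `univ` on which `x` has integral sums, a fractional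
coordinate is accompanied by another one that no member of the chain separates from it. -/
lemma exists_unseparated_fractional {x : Fin n → ℝ} (hx : ∀ i, x i ∈ Icc (0 : ℝ) 1)
    {𝒞 : Finset (Finset (Fin n))} (h0 : ∅ ∈ 𝒞) (h1 : Finset.univ ∈ 𝒞)
    (hchain : ∀ A ∈ 𝒞, ∀ B ∈ 𝒞, A ⊆ B ∨ B ⊆ A)
    (hint : ∀ A ∈ 𝒞, ∃ z : ℤ, coordSum x A = z) {u : Fin n} (hu0 : x u ≠ 0) (hu1 : x u ≠ 1) :
    ∃ v, v ≠ u ∧ x v ≠ 0 ∧ x v ≠ 1 ∧ ∀ A ∈ 𝒞, u ∈ A ↔ v ∈ A := by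
  -- A is the least member of the chain containing `u` and B the largest one missing it, so no
  -- member separates points of A \ B.
  obtain ⟨A, hA, hAmin⟩ := Finset.exists_min_image (𝒞.filter (u ∈ ·)) Finset.card
    ⟨Finset.univ, by simp [h1]⟩
  obtain ⟨B, hB, hBmax⟩ := Finset.exists_max_image (𝒞.filter (u ∉ ·)) Finset.card
    ⟨∅, by simp [h0]⟩
  rw [Finset.mem_filter] at hA hB
  have hA' : ∀ C ∈ 𝒞, u ∈ C → A ⊆ C := by
    intro C hC huC
    rcases hchain A hA.1 C hC with h | h
    · exact h
    · exact (Finset.eq_of_subset_of_card_le h (hAmin C (by simp [hC, huC]))).ge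
  have hB' : ∀ C ∈ 𝒞, u ∉ C → C ⊆ B := by
    intro C hC huC
    rcases hchain C hC B hB.1 with h | h
    · exact h
    · exact (Finset.eq_of_subset_of_card_le h (hBmax C (by simp [hC, huC]))).ge
  have hBA : B ⊆ A := (hchain B hB.1 A hA.1).resolve_right fun h => hB.2 (h hA.2)
  have huAB : u ∈ A \ B := Finset.mem_sdiff.2 ⟨hA.2, hB.2⟩
  -- The sum over A \ B is an integer; if every other coordinate there were 0 or 1, then x u would
  -- be an integer in [0,1].
  have key : ∃ v ∈ (A \ B).erase u, x v ≠ 0 ∧ x v ≠ 1 := by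
    by_contra! hcon
    obtain ⟨a, ha⟩ := hint A hA.1
    obtain ⟨b, hb⟩ := hint B hB.1
    have hsum : ∑ v ∈ (A \ B).erase u, x v
        = ((((A \ B).erase u).filter fun v => x v = 1).card : ℝ) := by
      rw [Finset.card_filter]
      push_cast
      refine Finset.sum_congr rfl fun v hv => ?_
      by_cases h : x v = 0
      · simp [h]
      · simp [hcon v hv h]
    have e1 := Finset.add_sum_erase (A \ B) x huAB
    have e2 := Finset.sum_sdiff (f := x) hBA
    unfold coordSum at ha hb
    have hxu : x u = ((a - b - ((((A \ B).erase u).filter fun v => x v = 1).card : ℤ) : ℤ) : ℝ) := by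
      push_cast; linarith
    set z := a - b - ((((A \ B).erase u).filter fun v => x v = 1).card : ℤ)
    have hz0 : (0 : ℤ) ≤ z := by have := (hx u).1; rw [hxu] at this; exact_mod_cast this
    have hz1 : z ≤ 1 := by have := (hx u).2; rw [hxu] at this; exact_mod_cast this
    have : z = 0 ∨ z = 1 := by omega
    rcases this with h | h
    · exact hu0 (by rw [hxu, h]; simp)
    · exact hu1 (by rw [hxu, h]; simp)
  obtain ⟨v, hv, hv0, hv1⟩ := key
  rw [Finset.mem_erase, Finset.mem_sdiff] at hv
  refine ⟨v, hv.1, hv0, hv1, fun C hC => ⟨fun h => hA' C hC h hv.2.1, fun h => ?_⟩⟩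
  by_contra hcon
  exact hv.2.2 (hB' C hC hcon h)

/-- A fractional coordinate u has a fractional partner v on the same side of every tight set. Moving
along e_u - e_v in either direction preserves the total and the tight constraints, and slack
constraints survive small moves, so the point is not extreme. -/
lemma zero_or_one_of_mem_extremePoints [Fintype ι] (hT : ∀ i j, T i ⊆ T j ∨ T j ⊆ T i)
    {x : Fin n → ℝ} (hx : x ∈ (rankPolytope k T r).extremePoints ℝ) (u : Fin n) :
    x u = 0 ∨ x u = 1 := by
  classical
  by_contra! hu
  have hxP := hx.1
  obtain ⟨⟨hx01, hxk⟩, hxr⟩ := hxP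
  set 𝒞 : Finset (Finset (Fin n)) := insert ∅ (insert Finset.univ
    ((Finset.univ.filter fun i => coordSum x (T i) = r i).image T)) with h𝒞
  obtain ⟨v, hvu, hv0, hv1, huv⟩ := exists_unseparated_fractional (𝒞 := 𝒞) hx01 (by simp [h𝒞])
    (by simp [h𝒞])
    (by
      intro A hA B hB
      simp only [h𝒞, Finset.mem_insert, Finset.mem_image, Finset.mem_filter, Finset.mem_univ,
        true_and] at hA hB
      rcases hA with rfl | rfl | ⟨i, -, rfl⟩
      · simp
      · simp
      · rcases hB with rfl | rfl | ⟨j, -, rfl⟩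
        · simp
        · simp
        · exact hT i j)
    (by
      intro A hA
      simp only [h𝒞, Finset.mem_insert, Finset.mem_image, Finset.mem_filter, Finset.mem_univ,
        true_and] at hA
      rcases hA with rfl | rfl | ⟨i, hi, rfl⟩
      · exact ⟨0, by simp [coordSum]⟩
      · exact ⟨k, by simpa [coordSum] using hxk⟩
      · exact ⟨r i, hi⟩)
    hu.1 hu.2
  set w : Fin n → ℝ := Pi.single u 1 - Pi.single v 1 with hw
  have hwu : w u = 1 := by simp [hw, hvu.symm]
  have hwJ : ∀ J : Finset (Fin n), (u ∈ J ↔ v ∈ J) → coordSum w J = 0 := by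
    intro J hJ
    simp only [coordSum, hw, Pi.sub_apply, Finset.sum_sub_distrib, Pi.single_apply,
      Finset.sum_ite_eq', hJ, sub_self]
  have hcont : ∀ J, Continuous fun ε : ℝ => coordSum (x + ε • w) J := fun J => by
    have := continuous_coordSum J; fun_prop
  refine notMem_extremePoints_of_direction (w := w) (fun h => ?_) ?_ hx
  · rw [h] at hwu; simp at hwu
  have hA : ∀ᶠ ε : ℝ in nhds 0, ∀ i, (x + ε • w) i ∈ Icc (0 : ℝ) 1 := by
    rw [Filter.eventually_all]
    intro i
    by_cases hi : i = u ∨ i = v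
    · have hio : x i ∈ Ioo (0 : ℝ) 1 := by
        rcases hi with rfl | rfl
        · exact ⟨lt_of_le_of_ne (hx01 _).1 hu.1.symm, lt_of_le_of_ne (hx01 _).2 hu.2⟩
        · exact ⟨lt_of_le_of_ne (hx01 _).1 hv0.symm, lt_of_le_of_ne (hx01 _).2 hv1⟩
      have hc : Continuous fun ε : ℝ => (x + ε • w) i := by
        simp only [Pi.add_apply, Pi.smul_apply]; fun_prop
      filter_upwards [hc.continuousAt.eventually_mem
        (s := Ioo 0 1) (isOpen_Ioo.mem_nhds (by simpa using hio))] with ε h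
      exact Ioo_subset_Icc_self h
    · push Not at hi
      have : w i = 0 := by simp [hw, hi.1, hi.2]
      simpa [this] using hx01 i
  have hB : ∀ᶠ ε : ℝ in nhds 0, ∀ i, (r i : ℝ) ≤ coordSum (x + ε • w) (T i) := by
    rw [Filter.eventually_all]
    intro i
    by_cases hi : coordSum x (T i) = r i
    · have := hwJ (T i) (huv (T i) (by
        simp only [h𝒞, Finset.mem_insert, Finset.mem_image, Finset.mem_filter]
        exact Or.inr (Or.inr ⟨i, by simpa using hi, rfl⟩)))
      simp [coordSum_add, coordSum_smul, this, hi]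
    · have hlt : (r i : ℝ) < coordSum x (T i) := lt_of_le_of_ne (hxr i) (Ne.symm hi)
      filter_upwards [(hcont (T i)).continuousAt.eventually_mem
        (s := Ioi (r i : ℝ)) (isOpen_Ioi.mem_nhds (by simpa using hlt))] with ε h
      exact le_of_lt h
  filter_upwards [hA, hB] with ε h1 h2
  refine ⟨⟨h1, ?_⟩, h2⟩
  have h3 := hwJ Finset.univ (by simp)
  have h4 : coordSum (x + ε • w) Finset.univ = coordSum x Finset.univ := by
    simp [coordSum_add, coordSum_smul, h3]
  exact h4.trans hxk

/-- Krein–Milman: the polytope is the closed hull of its extreme points, which are 0/1 vectors. -/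
lemma rankPolytope_eq_convexHull [Fintype ι] (hT : ∀ i j, T i ⊆ T j ∨ T j ⊆ T i) :
    rankPolytope k T r = convexHull ℝ {v | ∃ B : Finset (Fin n),
      (B.card = k ∧ ∀ i, r i ≤ ((B ∩ T i).card : ℤ)) ∧ v = eVec B} := by
  set V : Set (Fin n → ℝ) := {v | ∃ B : Finset (Fin n),
      (B.card = k ∧ ∀ i, r i ≤ ((B ∩ T i).card : ℤ)) ∧ v = eVec B} with hV
  have hfin : V.Finite := (Set.finite_range (eVec (n := n))).subset (by
    rintro v ⟨B, -, rfl⟩; exact ⟨B, rfl⟩)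
  apply Subset.antisymm
  · rw [← closure_convexHull_extremePoints isCompact_rankPolytope convex_rankPolytope]
    refine closure_minimal (convexHull_mono fun x hx => ?_) (hfin.isClosed_convexHull ℝ)
    have h := eq_eVec_of_zero_or_one (zero_or_one_of_mem_extremePoints hT hx)
    refine ⟨_, eVec_mem_rankPolytope.1 (h ▸ hx.1), h⟩
  · refine convexHull_min ?_ convex_rankPolytope
    rintro v ⟨B, hB, rfl⟩
    exact eVec_mem_rankPolytope.2 hB

/-- Removing e from A hurts only the tight constraints whose set contains e. It is enough to find f
in the smallest such set U, because the others contain U; and f exists in B \ A since tightness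
gives |A ∩ U| ≤ |B ∩ U| while e ∈ A \ B. -/
lemma exchange_of_chain [Fintype ι] (hT : ∀ i j, T i ⊆ T j ∨ T j ⊆ T i) {A B : Finset (Fin n)}
    (hA : A.card = k ∧ ∀ i, r i ≤ ((A ∩ T i).card : ℤ))
    (hB : B.card = k ∧ ∀ i, r i ≤ ((B ∩ T i).card : ℤ)) {e : Fin n} (heA : e ∈ A) (heB : e ∉ B) :
    ∃ f ∈ B \ A, (insert f (A.erase e)).card = k ∧
      ∀ i, r i ≤ ((insert f (A.erase e) ∩ T i).card : ℤ) := by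
  classical
  have key : ∃ f ∈ B \ A, ∀ i, e ∈ T i → r i = ((A ∩ T i).card : ℤ) → f ∈ T i := by
    have aux : ∀ U : Finset (Fin n), e ∈ U → (A ∩ U).card ≤ (B ∩ U).card →
        ∃ f ∈ B \ A, f ∈ U := by
      intro U heU hU
      by_contra! hcon
      have hsub : B ∩ U ⊆ (A ∩ U).erase e := by
        intro f hf
        rw [Finset.mem_inter] at hf
        have hfA : f ∈ A := by
          by_contra h
          exact hcon f (Finset.mem_sdiff.2 ⟨hf.1, h⟩) hf.2
        exact Finset.mem_erase.2 ⟨fun h => heB (h ▸ hf.1), Finset.mem_inter.2 ⟨hfA, hf.2⟩⟩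
      have h1 := Finset.card_le_card hsub
      have h2 := Finset.card_erase_lt_of_mem (Finset.mem_inter.2 ⟨heA, heU⟩)
      omega
    by_cases hne : (Finset.univ.filter fun i => e ∈ T i ∧ r i = ((A ∩ T i).card : ℤ)).Nonempty
    · obtain ⟨m, hm, hmin⟩ := Finset.exists_min_image _ (fun i => (T i).card) hne
      simp only [Finset.mem_filter, Finset.mem_univ, true_and] at hm hmin
      obtain ⟨f, hf, hfm⟩ := aux (T m) hm.1 (by have := hB.2 m; rw [hm.2] at this; exact_mod_cast this)
      refine ⟨f, hf, fun i hi1 hi2 => ?_⟩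
      rcases hT m i with h | h
      · exact h hfm
      · exact (Finset.eq_of_subset_of_card_le h (hmin i ⟨hi1, hi2⟩)).ge hfm
    · obtain ⟨f, hf, -⟩ := aux Finset.univ (by simp) (by simp [hA.1, hB.1])
      refine ⟨f, hf, fun i hi1 hi2 => (hne ⟨i, by simp [hi1, hi2]⟩).elim⟩
  obtain ⟨f, hf, hfT⟩ := key
  rw [Finset.mem_sdiff] at hf
  refine ⟨f, Finset.mem_sdiff.2 hf, ?_, fun i => ?_⟩
  · rw [Finset.card_insert_of_notMem (fun h => hf.2 (Finset.mem_of_mem_erase h)),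
      Finset.card_erase_add_one heA, hA.1]
  · have hAi := hA.2 i
    have hsub : (A ∩ T i).erase e ⊆ insert f (A.erase e) ∩ T i := by
      intro t ht
      simp only [Finset.mem_erase, Finset.mem_inter, Finset.mem_insert] at ht ⊢
      tauto
    have hc := Finset.card_le_card hsub
    by_cases hei : e ∈ T i
    · have hce := Finset.card_erase_add_one (Finset.mem_inter.2 ⟨heA, hei⟩)
      by_cases hti : r i = ((A ∩ T i).card : ℤ)
      · have hsub' : insert f ((A ∩ T i).erase e) ⊆ insert f (A.erase e) ∩ T i := by
          refine Finset.insert_subset ?_ hsub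
          simp [hfT i hei hti]
        have hc' := Finset.card_le_card hsub'
        rw [Finset.card_insert_of_notMem (by simp [hf.2])] at hc'
        omega
      · omega
    · rw [Finset.erase_eq_of_notMem (by simp [hei])] at hc
      omega

lemma isMatroidPolytope_rankPolytope [Fintype ι] (hT : ∀ i j, T i ⊆ T j ∨ T j ⊆ T i)
    (hne : (rankPolytope k T r).Nonempty) : IsMatroidPolytope (rankPolytope k T r) := by
  classical
  rw [rankPolytope_eq_convexHull hT] at hne ⊢
  obtain ⟨_, B₀, hB₀, -⟩ := convexHull_nonempty_iff.1 hne
  refine ⟨Matroid.ofIsBaseOfFinite (E := univ) finite_univ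
    (fun X => ∃ B : Finset (Fin n),
      (B.card = k ∧ ∀ i, r i ≤ ((B ∩ T i).card : ℤ)) ∧ (B : Set (Fin n)) = X)
    ⟨_, B₀, hB₀, rfl⟩ ?_ (fun _ _ => subset_univ _), rfl, ?_⟩
  · rintro _ _ ⟨A, hA, rfl⟩ ⟨B, hB, rfl⟩ e ⟨heA, heB⟩
    obtain ⟨f, hf, hfB⟩ := exchange_of_chain hT hA hB (Finset.mem_coe.1 heA) heB
    refine ⟨f, by simpa using hf, _, hfB, by simp⟩
  · congr 1
    ext v
    constructor
    · rintro ⟨B, hB, rfl⟩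
      exact ⟨B, ⟨B, hB, rfl⟩, rfl⟩
    · rintro ⟨B, ⟨B', hB', h⟩, rfl⟩
      rw [Finset.coe_inj] at h
      exact ⟨B, h ▸ hB', rfl⟩

end rankPolytope

lemma IsMatroidPolytope.isPolytope {n : ℕ} {Q : Set (Fin n → ℝ)} (h : IsMatroidPolytope Q) :
    IsPolytope Q := by
  obtain ⟨M, -, rfl⟩ := h
  exact ⟨_, (Set.finite_range (eVec (n := n))).subset (by rintro v ⟨B, -, rfl⟩; exact ⟨B, rfl⟩), rfl⟩

/-! ### The relative interior of the hypersimplex -/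

lemma sum_eq_of_mem_affineSpan_hypersimplex {n k : ℕ} {y : Fin n → ℝ}
    (hy : y ∈ affineSpan ℝ (hypersimplex k n)) : ∑ i, y i = k := by
  refine affineSpan_induction (p := fun y : Fin n → ℝ => ∑ i, y i = k) hy (fun x hx => hx.2) ?_
  intro c u v w hu hv hw
  simp [Finset.sum_add_distrib, ← Finset.mul_sum, Finset.sum_sub_distrib, hu, hv, hw]

/-- The points of the hypersimplex with all coordinates strictly between `0` and `1`. -/
def openHypersimplex (k n : ℕ) : Set (Fin n → ℝ) :=
  {x | (∀ i, x i ∈ Ioo (0 : ℝ) 1) ∧ ∑ i, x i = (k : ℝ)}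

lemma openHypersimplex_subset (k n : ℕ) : openHypersimplex k n ⊆ hypersimplex k n :=
  fun _ hx => ⟨fun i => Ioo_subset_Icc_self (hx.1 i), hx.2⟩

/-- The open unit cube. -/
def openCube (n : ℕ) : Set (Fin n → ℝ) := {x | ∀ i, x i ∈ Ioo (0 : ℝ) 1}

lemma isOpen_openCube (n : ℕ) : IsOpen (openCube n) := by
  simp only [openCube, ofPred_forall]
  exact isOpen_iInter_of_finite fun i => isOpen_Ioo.preimage (continuous_apply i)

lemma openHypersimplex_subset_intrinsicInterior (k n : ℕ) :
    openHypersimplex k n ⊆ intrinsicInterior ℝ (hypersimplex k n) := by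
  intro x hx
  refine mem_intrinsicInterior.2
    ⟨⟨x, subset_affineSpan ℝ _ (openHypersimplex_subset k n hx)⟩, ?_, rfl⟩
  refine mem_interior.2 ⟨Subtype.val ⁻¹' openCube n, ?_,
    (isOpen_openCube n).preimage continuous_subtype_val, hx.1⟩
  intro y hy
  exact ⟨fun i => Ioo_subset_Icc_self (hy i), sum_eq_of_mem_affineSpan_hypersimplex y.2⟩

lemma intrinsicInterior_hypersimplex {k n : ℕ} (hne : (openHypersimplex k n).Nonempty) :
    intrinsicInterior ℝ (hypersimplex k n) = openHypersimplex k n := by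
  refine Subset.antisymm ?_ (openHypersimplex_subset_intrinsicInterior k n)
  intro x hx
  obtain ⟨c, hc⟩ := hne
  have hxP := intrinsicInterior_subset hx
  obtain ⟨x', hx', rfl⟩ := mem_intrinsicInterior.1 hx
  have hcP : c ∈ affineSpan ℝ (hypersimplex k n) :=
    subset_affineSpan ℝ _ (openHypersimplex_subset k n hc)
  -- The line from `c` through x, continued past x: for small t > 0 it is still in the hypersimplex,
  -- which a coordinate equal to 0 or 1 would prevent.
  let γ : ℝ → affineSpan ℝ (hypersimplex k n) := fun t =>
    ⟨AffineMap.lineMap (x' : Fin n → ℝ) c (-t), AffineMap.lineMap_mem _ x'.2 hcP⟩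
  have hγ : Continuous γ := by
    refine Continuous.subtype_mk ?_ _
    exact AffineMap.lineMap_continuous.comp continuous_neg
  have hγ0 : γ 0 = x' := by ext; simp [γ]
  have hev : ∀ᶠ t in nhds (0 : ℝ), γ t ∈ interior (Subtype.val ⁻¹' (hypersimplex k n)) :=
    hγ.continuousAt.eventually_mem (isOpen_interior.mem_nhds (by rw [hγ0]; exact hx'))
  obtain ⟨δ, hδ, hδP⟩ := Metric.eventually_nhds_iff.1 hev
  have h1 := interior_subset (hδP (y := δ / 2) (by simp [abs_of_pos hδ]; linarith))
  have h2 : ∀ i, 0 ≤ x'.1 i + δ / 2 * (x'.1 i - c i) ∧ x'.1 i + δ / 2 * (x'.1 i - c i) ≤ 1 := by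
    intro i
    have := h1.1 i
    simp only [γ, AffineMap.lineMap_apply, vsub_eq_sub, vadd_eq_add, Pi.add_apply, Pi.smul_apply,
      Pi.sub_apply, smul_eq_mul, mem_Icc] at this
    constructor <;> nlinarith [this.1, this.2]
  refine ⟨fun i => ⟨lt_of_le_of_ne (hxP.1 i).1 fun h => ?_, lt_of_le_of_ne (hxP.1 i).2 fun h => ?_⟩,
    hxP.2⟩
  · have := (h2 i).1
    rw [← h] at this
    nlinarith [(hc.1 i).1, mul_pos hδ (hc.1 i).1]
  · have := (h2 i).2
    rw [h] at this
    nlinarith [(hc.1 i).2, mul_pos hδ (sub_pos.2 (hc.1 i).2)]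

/-! ### Dimensions -/

/-- Q lies in the flat x₀ + W and fills it near x₀. All dimensions below are computed this way. -/
lemma vectorSpan_eq_of_open {n : ℕ} {Q U : Set (Fin n → ℝ)} {W : Submodule ℝ (Fin n → ℝ)}
    {x₀ : Fin n → ℝ} (hx₀ : x₀ ∈ U) (hU : IsOpen U) (hQW : ∀ x ∈ Q, x - x₀ ∈ W)
    (hUQ : ∀ x ∈ U, x - x₀ ∈ W → x ∈ Q) : vectorSpan ℝ Q = W := by
  apply le_antisymm
  · rw [vectorSpan_def, Submodule.span_le]
    rintro _ ⟨x, hx, y, hy, rfl⟩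
    have := W.sub_mem (hQW x hx) (hQW y hy)
    simpa using this
  · intro w hw
    have hc : Continuous fun ε : ℝ => x₀ + ε • w := by fun_prop
    obtain ⟨δ, hδ, hδU⟩ := Metric.eventually_nhds_iff.1
      (hc.continuousAt.eventually_mem (x := (0 : ℝ)) (hU.mem_nhds (by simpa using hx₀)))
    have h1 : x₀ + (δ / 2) • w ∈ Q :=
      hUQ _ (hδU (by simp [abs_of_pos hδ]; linarith)) (by simpa using W.smul_mem _ hw)
    have h0 : x₀ ∈ Q := hUQ _ hx₀ (by simp)
    have h2 := vsub_mem_vectorSpan ℝ h1 h0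
    have h3 := (vectorSpan ℝ Q).smul_mem (δ / 2)⁻¹ h2
    have hne : δ / 2 ≠ 0 := by positivity
    rwa [vsub_eq_sub, add_sub_cancel_left, smul_smul, inv_mul_cancel₀ hne, one_smul] at h3

/-- The subspace of the vectors whose coordinates sum to zero over every fibre of `p`. -/
def fibreSumZero {n : ℕ} {κ : Type*} [DecidableEq κ] (p : Fin n → κ) :
    Submodule ℝ (Fin n → ℝ) where
  carrier := {v | ∀ c, ∑ t with p t = c, v t = 0}
  zero_mem' := by simp
  add_mem' := by
    intro a b ha hb c
    simp only [mem_ofPred_eq] at ha hb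
    simp [Finset.sum_add_distrib, ha, hb]
  smul_mem' := by
    intro r a ha c
    simp only [mem_ofPred_eq] at ha
    simp [← Finset.mul_sum, ha]

lemma mem_fibreSumZero {n : ℕ} {κ : Type*} [DecidableEq κ] {p : Fin n → κ} {v : Fin n → ℝ} :
    v ∈ fibreSumZero p ↔ ∀ c, ∑ t with p t = c, v t = 0 := Iff.rfl

/-- Rank–nullity for the map of fibre sums, which is surjective: put the prescribed value on one
representative of each fibre. -/
lemma finrank_fibreSumZero {n : ℕ} {κ : Type*} [DecidableEq κ] [Fintype κ] {p : Fin n → κ}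
    (hp : Function.Surjective p) :
    Module.finrank ℝ (fibreSumZero p) + Fintype.card κ = n := by
  let L : (Fin n → ℝ) →ₗ[ℝ] (κ → ℝ) :=
    { toFun := fun v c => ∑ t with p t = c, v t
      map_add' := by intro a b; ext c; simp [Finset.sum_add_distrib]
      map_smul' := by intro r a; ext c; simp [← Finset.mul_sum] }
  have hker : L.ker = fibreSumZero p := by
    ext v
    rw [LinearMap.mem_ker, mem_fibreSumZero, funext_iff]
    rfl
  have hrange : L.range = ⊤ := by
    rw [LinearMap.range_eq_top]
    intro w
    obtain ⟨q, hq⟩ := hp.hasRightInverse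
    refine ⟨fun t => if q (p t) = t then w (p t) else 0, ?_⟩
    funext c
    change (∑ t with p t = c, if q (p t) = t then w (p t) else 0) = w c
    rw [Finset.sum_eq_single (q c)]
    · simp [hq c]
    · intro t ht htc
      simp only [Finset.mem_filter, Finset.mem_univ, true_and] at ht
      rw [ht, if_neg (Ne.symm htc)]
    · intro h
      simp [hq c] at h
  have := L.finrank_range_add_finrank_ker
  rw [hker, hrange, finrank_top] at this
  simp only [Module.finrank_fintype_fun_eq_card, Fintype.card_fin] at this
  omega

/-! ### Coarsenings of subdivisions -/

/-- The exposing functional is constant on F, so it kills the span of F, which by dimension is that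
of Q; hence it is constant on Q. -/
lemma eq_of_isExposed_of_polyDim_eq {n : ℕ} {Q F : Set (Fin n → ℝ)} (hF : IsExposed ℝ Q F)
    (hne : F.Nonempty) (hdim : polyDim F = polyDim Q) : F = Q := by
  obtain ⟨l, hl⟩ := hF hne
  have hFQ : F ⊆ Q := by rw [hl]; exact fun x hx => hx.1
  have hspan : vectorSpan ℝ F = vectorSpan ℝ Q :=
    Submodule.eq_of_le_of_finrank_eq (vectorSpan_mono ℝ hFQ) hdim
  have hker : vectorSpan ℝ F ≤ LinearMap.ker (l : (Fin n → ℝ) →ₗ[ℝ] ℝ) := by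
    rw [vectorSpan_def, Submodule.span_le]
    rintro _ ⟨x, hx, y, hy, rfl⟩
    rw [hl] at hx hy
    have := le_antisymm (hx.2 y hy.1) (hy.2 x hx.1)
    simp [this]
  refine Subset.antisymm hFQ fun x hx => ?_
  obtain ⟨z, hz⟩ := hne
  have h1 := hker (hspan ▸ vsub_mem_vectorSpan ℝ hx (hFQ hz))
  have h2 : l x = l z := by
    have : l (x - z) = 0 := by simpa using h1
    rwa [map_sub, sub_eq_zero] at this
  rw [hl] at hz ⊢
  exact ⟨hx, fun y hy => h2 ▸ hz.2 y hy⟩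

lemma IsSubdivision.eq_of_subset {n : ℕ} {P : Set (Fin n → ℝ)} {𝒯 : Set (Set (Fin n → ℝ))}
    (h : IsSubdivision P 𝒯) {R R' : Set (Fin n → ℝ)} (hR : R ∈ 𝒯) (hR' : R' ∈ 𝒯)
    (hsub : R ⊆ R') : R = R' := by
  have hf := (h.face_inter R hR R' hR').2
  rw [inter_eq_left.2 hsub] at hf
  exact eq_of_isExposed_of_polyDim_eq hf (h.nonempty R hR)
    ((h.dim_eq R hR).trans (h.dim_eq R' hR').symm)

lemma IsExposed.openSegment_notMem {n : ℕ} {Q F : Set (Fin n → ℝ)} (hF : IsExposed ℝ Q F)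
    {x y : Fin n → ℝ} (hx : x ∈ Q) (hy : y ∈ Q) (hyF : y ∉ F) {a b : ℝ} (ha : 0 ≤ a) (hb : 0 < b)
    (hab : a + b = 1) : a • x + b • y ∉ F := by
  intro hz
  obtain ⟨l, hl⟩ := hF ⟨_, hz⟩
  apply hyF
  rw [hl] at hz ⊢
  refine ⟨hy, fun w hw => (hz.2 w hw).trans ?_⟩
  have h1 := hz.2 x hx
  simp only [map_add, map_smul, smul_eq_mul] at h1 ⊢
  obtain rfl : a = 1 - b := by linarith
  nlinarith [mul_le_mul_of_nonneg_left h1 ha]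

/-- Finitely many proper faces never cover a convex set: the midpoint of a point avoiding the
earlier faces and a point avoiding the new one avoids them all. -/
lemma exists_notMem_of_isExposed {n : ℕ} {Q : Set (Fin n → ℝ)} (hconv : Convex ℝ Q)
    (hne : Q.Nonempty) {𝓕 : Set (Set (Fin n → ℝ))} (hfin : 𝓕.Finite)
    (h : ∀ F ∈ 𝓕, IsExposed ℝ Q F ∧ F ≠ Q) : ∃ y ∈ Q, ∀ F ∈ 𝓕, y ∉ F := by
  induction 𝓕, hfin using Set.Finite.induction_on with
  | empty => obtain ⟨y, hy⟩ := hne; exact ⟨y, hy, by simp⟩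
  | @insert F 𝓕 _ _ ih =>
    obtain ⟨y, hy, hy'⟩ := ih fun F' hF' => h F' (mem_insert_of_mem _ hF')
    obtain ⟨hF, hFQ⟩ := h F (mem_insert _ _)
    obtain ⟨z, hz, hzF⟩ : ∃ z ∈ Q, z ∉ F := by
      by_contra! hcon
      exact hFQ (Subset.antisymm hF.subset hcon)
    have hmem : (1 / 2 : ℝ) • y + (1 / 2 : ℝ) • z ∈ Q :=
      hconv hy hz (by norm_num) (by norm_num) (by norm_num)
    refine ⟨_, hmem, ?_⟩
    rintro F' (rfl | hF')
    · exact hF.openSegment_notMem hy hz hzF (by norm_num) (by norm_num) (by norm_num)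
    · rw [add_comm]
      exact (h F' (mem_insert_of_mem _ hF')).1.openSegment_notMem hz hy (hy' F' hF')
        (by norm_num) (by norm_num) (by norm_num)

lemma IsPolytope.convex {n : ℕ} {Q : Set (Fin n → ℝ)} (h : IsPolytope Q) : Convex ℝ Q := by
  obtain ⟨V, -, rfl⟩ := h
  exact convex_convexHull ℝ V

lemma IsPolytope.isClosed {n : ℕ} {Q : Set (Fin n → ℝ)} (h : IsPolytope Q) : IsClosed Q := by
  obtain ⟨V, hV, rfl⟩ := h
  exact hV.isClosed_convexHull ℝ

/-- A cell of a coarsening of a subdivision is the union of the finer cells it contains. -/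
lemma IsSubdivision.eq_sUnion_of_refines {n : ℕ} {P : Set (Fin n → ℝ)}
    {𝒮 𝒯 : Set (Set (Fin n → ℝ))} (h𝒮 : IsSubdivision P 𝒮) (h𝒯 : IsSubdivision P 𝒯)
    (href : ∀ Q ∈ 𝒮, ∃ R ∈ 𝒯, Q ⊆ R) {R : Set (Fin n → ℝ)} (hR : R ∈ 𝒯) :
    R = ⋃₀ {Q ∈ 𝒮 | Q ⊆ R} := by
  refine Subset.antisymm ?_ (sUnion_subset fun Q hQ => hQ.2)
  have hclosed : IsClosed (⋃₀ {Q ∈ 𝒮 | Q ⊆ R}) :=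
    by
      rw [sUnion_eq_biUnion]
      exact (h𝒮.finite.subset (sep_subset _ _)).isClosed_biUnion
        fun Q hQ => (h𝒮.polytope Q hQ.1).isClosed
  have hRconv := (h𝒯.polytope R hR).convex
  have hproper : ∀ R' ∈ 𝒯, R' ≠ R → R ∩ R' ≠ R := fun R' hR' hne h =>
    hne (h𝒯.eq_of_subset hR hR' (inter_eq_left.1 h)).symm
  -- Starting from x and moving towards `y`, which lies in no other coarse cell, one meets only
  -- points whose fine cells must lie in R. Let the point return to x and use closedness.
  obtain ⟨y, hy, hyF⟩ := exists_notMem_of_isExposed hRconv (h𝒯.nonempty R hR)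
    (𝓕 := (fun R' => R ∩ R') '' (𝒯 \ {R})) ((h𝒯.finite.subset sdiff_subset).image _) (by
      rintro _ ⟨R', ⟨hR', hne⟩, rfl⟩
      exact ⟨(h𝒯.face_inter R hR R' hR').1, hproper R' hR' hne⟩)
  intro x hx
  have hpt : ∀ t : ℝ, t ∈ Ioc (0 : ℝ) 1 → (1 - t) • x + t • y ∈ ⋃₀ {Q ∈ 𝒮 | Q ⊆ R} := by
    intro t ht
    have hzR : (1 - t) • x + t • y ∈ R :=
      hRconv hx hy (by linarith [ht.2]) ht.1.le (by ring)
    have hzP : (1 - t) • x + t • y ∈ ⋃₀ 𝒮 := by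
      rw [h𝒮.cover, ← h𝒯.cover]; exact ⟨R, hR, hzR⟩
    obtain ⟨Q, hQ, hzQ⟩ := hzP
    obtain ⟨R', hR', hQR'⟩ := href Q hQ
    have hRR' : R' = R := by
      by_contra hne
      exact (h𝒯.face_inter R hR R' hR').1.openSegment_notMem hx hy
        (hyF _ ⟨R', ⟨hR', hne⟩, rfl⟩) (by linarith [ht.2]) ht.1 (by ring) ⟨hzR, hQR' hzQ⟩
    exact ⟨Q, ⟨hQ, hRR' ▸ hQR'⟩, hzQ⟩
  have hc : Continuous fun t : ℝ => (1 - t) • x + t • y := by fun_prop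
  have hlim : Filter.Tendsto (fun t : ℝ => (1 - t) • x + t • y) (nhdsWithin 0 (Ioi 0)) (nhds x) := by
    have := hc.tendsto 0
    simp only [sub_zero, one_smul, zero_smul, add_zero] at this
    exact this.mono_left nhdsWithin_le_nhds
  refine hclosed.mem_of_tendsto hlim ?_
  filter_upwards [Ioc_mem_nhdsGT (zero_lt_one' ℝ)] with t ht using hpt t ht

/-! ### Partial sums of cyclic sequences -/

/-- The sum of the first `t` terms of the periodic extension of `d`. -/
def cyclicSum {ℓ : ℕ} [NeZero ℓ] (d : Fin ℓ → ℝ) (t : ℕ) : ℝ :=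
  ∑ i ∈ Finset.range t, d (Fin.ofNat ℓ i)

section cyclicSum

variable {ℓ : ℕ} [NeZero ℓ] {d : Fin ℓ → ℝ}

lemma sum_Iio_eq_sum_range (g : Fin ℓ → ℝ) (m : Fin ℓ) :
    ∑ i ∈ Finset.Iio m, g i = ∑ t ∈ Finset.range m, g (Fin.ofNat ℓ t) := by
  refine Finset.sum_nbij' (fun i => (i : ℕ)) (fun t => Fin.ofNat ℓ t) ?_ ?_ ?_ ?_ ?_
  · intro i hi
    simpa using hi
  · intro t ht
    have ht' : t < m := by simpa using ht
    simp [Fin.lt_def, Nat.mod_eq_of_lt (ht'.trans m.2), ht']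
  · intro i _
    simp
  · intro t ht
    have ht' : t < m := by simpa using ht
    simp [Nat.mod_eq_of_lt (ht'.trans m.2)]
  · intro i _
    simp

lemma cyclicSum_eq_sum_Iio (m : Fin ℓ) : cyclicSum d m = ∑ i ∈ Finset.Iio m, d i :=
  (sum_Iio_eq_sum_range d m).symm

lemma cyclicSum_card : cyclicSum d ℓ = ∑ i, d i := by
  rw [cyclicSum, Finset.sum_range]
  simp

lemma cyclicSum_succ (t : ℕ) : cyclicSum d (t + 1) = cyclicSum d t + d (Fin.ofNat ℓ t) := by
  rw [cyclicSum, Finset.sum_range_succ, cyclicSum]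

lemma cyclicSum_add_card (hd : ∑ i, d i = 0) (t : ℕ) : cyclicSum d (t + ℓ) = cyclicSum d t := by
  have h : cyclicSum d (ℓ + t) = cyclicSum d ℓ + ∑ i ∈ Finset.range t, d (Fin.ofNat ℓ (ℓ + i)) := by
    rw [cyclicSum, Finset.sum_range_add, cyclicSum]
  rw [add_comm, h, cyclicSum_card, hd, zero_add, cyclicSum]
  refine Finset.sum_congr rfl fun i _ => ?_
  congr 1
  ext
  simp

lemma cyclicSum_mod (hd : ∑ i, d i = 0) (t : ℕ) : cyclicSum d (t % ℓ) = cyclicSum d t := by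
  have h : ∀ q r : ℕ, cyclicSum d (r + ℓ * q) = cyclicSum d r := by
    intro q r
    induction q with
    | zero => simp
    | succ q ih => rw [mul_add, mul_one, ← add_assoc, cyclicSum_add_card hd, ih]
  conv_rhs => rw [← Nat.mod_add_div t ℓ]
  exact (h _ _).symm

/-- Since the total is 0, the partial sums are periodic, and a sum over a cyclic stretch is a
difference of two of them even when it wraps around. -/
lemma sum_Iio_rotate (hd : ∑ i, d i = 0) (j m : Fin ℓ) :
    ∑ i ∈ Finset.Iio m, d (j + i) = cyclicSum d (j + m : Fin ℓ) - cyclicSum d j := by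
  rw [sum_Iio_eq_sum_range (fun i => d (j + i)), Fin.val_add, cyclicSum_mod hd, cyclicSum,
    cyclicSum, Finset.sum_range_add, add_sub_cancel_left]
  refine Finset.sum_congr rfl fun i _ => ?_
  congr 1
  ext
  simp [Fin.val_add]

end cyclicSum

/-! ### Heights -/

/-- The amount `x_{S_i} - s_i` by which `x` exceeds the decoration of a block. -/
def blockExcess {n ℓ : ℕ} (S : Fin ℓ → Finset (Fin n)) (s : Fin ℓ → ℤ) (x : Fin n → ℝ)
    (i : Fin ℓ) : ℝ :=
  coordSum x (S i) - s i

/-- The height `∑_{i < j} (x_{S_i} - s_i)` of `x` before the block `j`. -/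
def height {n ℓ : ℕ} [NeZero ℓ] (S : Fin ℓ → Finset (Fin n)) (s : Fin ℓ → ℤ) (j : Fin ℓ)
    (x : Fin n → ℝ) : ℝ :=
  cyclicSum (blockExcess S s x) j

section heights

variable {n ℓ : ℕ} {S : Fin ℓ → Finset (Fin n)} {s : Fin ℓ → ℤ}

lemma coordSum_biUnion (hS : ∀ i j, i ≠ j → Disjoint (S i) (S j)) {ι : Type*} [DecidableEq ι]
    (A : Finset ι) {e : ι → Fin ℓ} (he : Function.Injective e) (x : Fin n → ℝ) :
    coordSum x (A.biUnion fun i => S (e i)) = ∑ i ∈ A, coordSum x (S (e i)) :=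
  Finset.sum_biUnion fun _ _ _ _ hij => hS _ _ (he.ne hij)

lemma IsDecoratedOSP.sum_coordSum {k : ℤ} (h : IsDecoratedOSP k S s) (x : Fin n → ℝ) :
    ∑ i, coordSum x (S i) = ∑ t, x t := by
  refine (coordSum_biUnion h.disjoint Finset.univ (e := id) Function.injective_id x).symm.trans ?_
  unfold coordSum
  congr 1
  ext t
  simpa using h.cover t

lemma IsDecoratedOSP.sum_blockExcess {k : ℤ} (h : IsDecoratedOSP k S s) (x : Fin n → ℝ) :
    ∑ i, blockExcess S s x i = ∑ t, x t - k := by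
  simp only [blockExcess, Finset.sum_sub_distrib, h.sum_coordSum, ← h.sum_eq, Int.cast_sum]

variable [NeZero ℓ]

lemma height_combo {j : Fin ℓ} {x y : Fin n → ℝ} {a b : ℝ} (hab : a + b = 1) :
    height S s j (a • x + b • y) = a * height S s j x + b * height S s j y := by
  simp only [height, cyclicSum, blockExcess, coordSum_add, coordSum_smul, Finset.mul_sum,
    ← Finset.sum_add_distrib]
  refine Finset.sum_congr rfl fun i _ => ?_
  linear_combination (s (Fin.ofNat ℓ i) : ℝ) * hab

lemma continuous_height (j : Fin ℓ) : Continuous (height S s j) := by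
  unfold height cyclicSum blockExcess
  exact continuous_finsetSum _ fun i _ => (continuous_coordSum _).sub continuous_const

/-- The dictionary between inequalities of rotated plates and comparisons of heights. -/
lemma IsDecoratedOSP.coordSum_rotate_sub {k : ℤ} (h : IsDecoratedOSP k S s) {x : Fin n → ℝ}
    (hx : ∑ t, x t = k) (j m : Fin ℓ) :
    coordSum x ((Finset.Iio m).biUnion fun i => S (j + i))
      - ((∑ i ∈ Finset.Iio m, s (j + i) : ℤ) : ℝ) = height S s (j + m) x - height S s j x := by
  rw [coordSum_biUnion h.disjoint _ (add_right_injective j), height, height,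
    ← sum_Iio_rotate (by rw [h.sum_blockExcess, hx, sub_self])]
  simp [blockExcess, Finset.sum_sub_distrib]

/-- A point lies in the blade if and only if its minimal height is attained at least twice. -/
lemma IsDecoratedOSP.mem_blade_iff {k : ℤ} (h : IsDecoratedOSP k S s) {x : Fin n → ℝ} :
    x ∈ blade k S s ↔ ∑ t, x t = k ∧ ∃ j, (∀ m, height S s j x ≤ height S s m x) ∧
      ∃ m, m ≠ j ∧ height S s m x = height S s j x := by
  simp only [blade, mem_iUnion, plateBoundary, plate, hyperplaneH, mem_ofPred_eq]
  constructor
  · rintro ⟨j, ⟨hx, h1⟩, m, hm, h2⟩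
    refine ⟨hx, j, fun m' => ?_, j + m, ?_, ?_⟩
    · have := h.coordSum_rotate_sub hx j (m' - j)
      have := h1 (m' - j)
      rw [add_sub_cancel] at *
      linarith
    · intro h3
      rw [add_eq_left] at h3
      simp [h3] at hm
    · have := h.coordSum_rotate_sub hx j m
      linarith
  · rintro ⟨hx, j, h1, m, hm, h2⟩
    refine ⟨j, ⟨hx, fun m' => ?_⟩, m - j, ?_, ?_⟩
    · have := h.coordSum_rotate_sub hx j m'
      have := h1 (j + m')
      linarith
    · rw [Nat.pos_iff_ne_zero, Ne, Fin.val_eq_zero_iff, sub_eq_zero]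
      exact hm
    · have := h.coordSum_rotate_sub hx j (m - j)
      rw [add_sub_cancel] at this
      linarith

variable {k : ℕ}

/-- All small height profiles are realised by interior points of the hypersimplex. -/
lemma IsHypersimplicialOSP.exists_height_eq (h : IsHypersimplicialOSP (k : ℤ) S s)
    {g : Fin ℓ → ℝ} (hg : ∀ j, |g j| ≤ 1 / 4) :
    ∃ x ∈ openHypersimplex k n, ∀ j, height S s j x = g j - g 0 := by
  choose β hβ using h.cover
  have hβ' : ∀ i t, t ∈ S i → β t = i := fun i t ht => by
    by_contra hne
    exact Finset.disjoint_left.1 (h.disjoint _ _ hne) (hβ t) ht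
  -- Spread s_i + g(i+1) - g(i) evenly over the block S_i. The bound 1/4 keeps the increment within
  -- 1/2, so the block total stays strictly between 0 and |S_i|.
  set x : Fin n → ℝ := fun t => (s (β t) + (g (β t + 1) - g (β t))) / ((S (β t)).card : ℝ) with hx
  have hcard : ∀ i, (0 : ℝ) < (S i).card := fun i => by
    exact_mod_cast Finset.card_pos.2 (h.nonempty i)
  have hS : ∀ i, blockExcess S s x i = g (i + 1) - g i := by
    intro i
    have : coordSum x (S i) = s i + (g (i + 1) - g i) := by
      unfold coordSum
      rw [Finset.sum_congr rfl (g := fun _ => (s i + (g (i + 1) - g i)) / ((S i).card : ℝ))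
        (fun t ht => by rw [hx]; simp only [hβ' i t ht])]
      rw [Finset.sum_const, nsmul_eq_mul, mul_div_cancel₀ _ (hcard i).ne']
    rw [blockExcess, this]
    ring
  refine ⟨x, ⟨fun t => ?_, ?_⟩, fun j => ?_⟩
  · have h1 := abs_le.1 (hg (β t))
    have h2 := abs_le.1 (hg (β t + 1))
    have h3 : (1 : ℝ) ≤ s (β t) := by exact_mod_cast h.one_le (β t)
    have h4 : (s (β t) : ℝ) ≤ (S (β t)).card - 1 := by exact_mod_cast h.le_card_sub_one (β t)
    constructor
    · exact div_pos (by linarith) (hcard _)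
    · rw [hx]
      simp only
      rw [div_lt_one (hcard _)]
      linarith
  · have h1 := h.sum_blockExcess x
    have h2 : ∑ i, g (i + 1) = ∑ i, g i := Equiv.sum_comp (Equiv.addRight 1) g
    simp only [hS, Finset.sum_sub_distrib, h2, sub_self] at h1
    have : ∑ t, x t = ((k : ℤ) : ℝ) := by linarith
    exact_mod_cast this
  · have h1 := Finset.sum_range_sub (fun t => g (Fin.ofNat ℓ t)) (j : ℕ)
    have h2 : ∀ t : ℕ, Fin.ofNat ℓ (t + 1) = Fin.ofNat ℓ t + 1 := fun t => by
      ext; simp [Fin.val_add]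
    simp only [h2] at h1
    rw [height, cyclicSum]
    simp only [hS]
    rw [h1]
    simp

end heights

/-! ### Cells and chambers -/

/-- The part of the hypersimplex on which the height before block `j` is minimal. -/
def cell {n ℓ : ℕ} [NeZero ℓ] (k : ℕ) (S : Fin ℓ → Finset (Fin n)) (s : Fin ℓ → ℤ) (j : Fin ℓ) :
    Set (Fin n → ℝ) :=
  hypersimplex k n ∩ {x | ∀ m, height S s j x ≤ height S s m x}

/-- The part of the open hypersimplex on which only the height before block `j` is minimal. -/
def chamber {n ℓ : ℕ} [NeZero ℓ] (k : ℕ) (S : Fin ℓ → Finset (Fin n)) (s : Fin ℓ → ℤ)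
    (j : Fin ℓ) : Set (Fin n → ℝ) :=
  openHypersimplex k n ∩ {x | ∀ m, m ≠ j → height S s j x < height S s m x}

section cells

variable {n ℓ k : ℕ} [NeZero ℓ] {S : Fin ℓ → Finset (Fin n)} {s : Fin ℓ → ℤ}

lemma isClosed_cell (j : Fin ℓ) : IsClosed (cell k S s j) := by
  refine (isClosed_hypersimplex k n).inter ?_
  simp only [ofPred_forall]
  exact isClosed_iInter fun m => isClosed_le (continuous_height j) (continuous_height m)

lemma openHypersimplex_combo {x y : Fin n → ℝ} (hx : x ∈ hypersimplex k n)
    (hy : y ∈ openHypersimplex k n) {a b : ℝ} (ha : 0 ≤ a) (hb : 0 < b) (hab : a + b = 1) :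
    a • x + b • y ∈ openHypersimplex k n := by
  refine ⟨fun i => ?_, (convex_hypersimplex k n hx (openHypersimplex_subset k n hy) ha hb.le hab).2⟩
  have h1 := hx.1 i
  have h2 := hy.1 i
  simp only [Pi.add_apply, Pi.smul_apply, smul_eq_mul]
  have h3 := mul_nonneg ha h1.1
  have h4 := mul_pos hb h2.1
  have h5 := mul_le_mul_of_nonneg_left h1.2 ha
  have h6 := mul_lt_mul_of_pos_left h2.2 hb
  exact ⟨by linarith, by linarith⟩

lemma chamber_combo {j : Fin ℓ} {x y : Fin n → ℝ} (hx : x ∈ cell k S s j)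
    (hy : y ∈ chamber k S s j) {a b : ℝ} (ha : 0 ≤ a) (hb : 0 < b) (hab : a + b = 1) :
    a • x + b • y ∈ chamber k S s j := by
  refine ⟨openHypersimplex_combo hx.1 hy.1 ha hb hab, fun m hm => ?_⟩
  rw [height_combo hab, height_combo hab]
  exact add_lt_add_of_le_of_lt (mul_le_mul_of_nonneg_left (hx.2 m) ha)
    (mul_lt_mul_of_pos_left (hy.2 m hm) hb)

lemma chamber_subset_cell (j : Fin ℓ) : chamber k S s j ⊆ cell k S s j := by
  refine fun x hx => ⟨openHypersimplex_subset k n hx.1, fun m => ?_⟩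
  by_cases h : m = j
  · rw [h]
  · exact (hx.2 m h).le

lemma convex_chamber (j : Fin ℓ) : Convex ℝ (chamber k S s j) := by
  intro x hx y hy a b ha hb hab
  rcases hb.eq_or_lt with rfl | hb
  · obtain rfl : a = 1 := by linarith
    simpa using hx
  · exact chamber_combo (chamber_subset_cell j hx) hy ha hb hab

lemma IsHypersimplicialOSP.chamber_nonempty (h : IsHypersimplicialOSP (k : ℤ) S s) (j : Fin ℓ) :
    (chamber k S s j).Nonempty := by
  obtain ⟨x, hx, hg⟩ := h.exists_height_eq (g := fun i => if i = j then -(1 / 4) else 0)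
    (fun i => by split_ifs <;> norm_num [abs_of_pos])
  refine ⟨x, hx, fun m hm => ?_⟩
  rw [hg, hg]
  simp only [hm, if_true, if_false]
  linarith

/-- Any point of the cell is a limit along the segment to a chamber point, and this segment is in
the chamber except possibly at its start. -/
lemma IsHypersimplicialOSP.closure_chamber (h : IsHypersimplicialOSP (k : ℤ) S s) (j : Fin ℓ) :
    closure (chamber k S s j) = cell k S s j := by
  refine Subset.antisymm (closure_minimal (chamber_subset_cell j) (isClosed_cell j)) fun x hx => ?_
  obtain ⟨y, hy⟩ := h.chamber_nonempty j
  have hc : Continuous fun t : ℝ => (1 - t) • x + t • y := by fun_prop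
  have hlim : Filter.Tendsto (fun t : ℝ => (1 - t) • x + t • y) (nhdsWithin 0 (Ioi 0)) (nhds x) := by
    have := hc.tendsto 0
    simp only [sub_zero, one_smul, zero_smul, add_zero] at this
    exact this.mono_left nhdsWithin_le_nhds
  refine mem_closure_of_tendsto hlim ?_
  filter_upwards [Ioc_mem_nhdsGT (zero_lt_one' ℝ)] with t ht
  exact chamber_combo hx hy (by linarith [ht.2]) ht.1 (by ring)

lemma IsHypersimplicialOSP.openHypersimplex_diff_blade (h : IsHypersimplicialOSP (k : ℤ) S s) :
    openHypersimplex k n \ blade (k : ℤ) S s = ⋃ j, chamber k S s j := by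
  ext x
  simp only [mem_sdiff, h.mem_blade_iff, mem_iUnion]
  constructor
  · rintro ⟨hx, hb⟩
    obtain ⟨j, hj⟩ := Finite.exists_min fun j => height S s j x
    refine ⟨j, hx, fun m hm => lt_of_le_of_ne (hj m) fun he => hb ?_⟩
    exact ⟨by exact_mod_cast hx.2, j, hj, m, hm, he.symm⟩
  · rintro ⟨j, hx, hj⟩
    refine ⟨hx, ?_⟩
    rintro ⟨-, i, hi, m, hmi, hm⟩
    by_cases hij : i = j
    · subst hij
      exact (hj m hmi).ne' hm
    · exact absurd (hi j) (not_le.2 (hj i hij))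

/-- Each chamber is convex, and disjoint open conditions on the heights separate it from the others.
-/
lemma connectedComponentIn_chamber {j : Fin ℓ} {x : Fin n → ℝ} (hx : x ∈ chamber k S s j) :
    connectedComponentIn (⋃ j, chamber k S s j) x = chamber k S s j := by
  refine Subset.antisymm ?_ ((convex_chamber j).isPreconnected.subset_connectedComponentIn hx
    (subset_iUnion _ j))
  have hopen : ∀ i, IsOpen {y : Fin n → ℝ | ∀ m, m ≠ i → height S s i y < height S s m y} := by
    intro i
    simp only [ofPred_forall]
    exact isOpen_iInter_of_finite fun m => isOpen_iInter_of_finite fun _ =>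
      isOpen_lt (continuous_height i) (continuous_height m)
  have hxF : x ∈ ⋃ j, chamber k S s j := mem_iUnion.2 ⟨j, hx⟩
  have hsub := connectedComponentIn_subset (⋃ j, chamber k S s j) x
  have key := IsPreconnected.subset_left_of_subset_union
    (s := connectedComponentIn (⋃ j, chamber k S s j) x)
    (hopen j) (isOpen_biUnion fun i (_ : i ≠ j) => hopen i) ?_ ?_
    ⟨x, mem_connectedComponentIn hxF, hx.2⟩ isPreconnected_connectedComponentIn
  · intro y hy
    obtain ⟨i, hi⟩ := mem_iUnion.1 (hsub hy)
    exact ⟨hi.1, key hy⟩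
  · rw [Set.disjoint_left]
    intro y hy hy'
    simp only [mem_iUnion] at hy'
    obtain ⟨i, hij, hi⟩ := hy'
    exact lt_asymm (hy i hij) (hi j (Ne.symm hij))
  · intro y hy
    obtain ⟨i, hi⟩ := mem_iUnion.1 (hsub hy)
    by_cases hij : i = j
    · exact Or.inl (hij ▸ hi.2)
    · exact Or.inr (mem_iUnion₂.2 ⟨i, hij, hi.2⟩)

lemma IsHypersimplicialOSP.openHypersimplex_nonempty (h : IsHypersimplicialOSP (k : ℤ) S s) :
    (openHypersimplex k n).Nonempty :=
  let ⟨x, hx⟩ := h.chamber_nonempty 0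
  ⟨x, hx.1⟩

lemma IsHypersimplicialOSP.inducedCells_eq (h : IsHypersimplicialOSP (k : ℤ) S s)
    {𝓑 : Set (Fin n → ℝ)} (h𝓑 : 𝓑 ∩ intrinsicInterior ℝ (hypersimplex k n) =
      blade (k : ℤ) S s ∩ intrinsicInterior ℝ (hypersimplex k n)) :
    inducedCells (hypersimplex k n) 𝓑 = range (cell k S s) := by
  have hset : intrinsicInterior ℝ (hypersimplex k n) \ 𝓑 = ⋃ j, chamber k S s j := by
    rw [← h.openHypersimplex_diff_blade,
      ← intrinsicInterior_hypersimplex h.openHypersimplex_nonempty, ← sdiff_inter_self_eq_sdiff, h𝓑,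
      sdiff_inter_self_eq_sdiff]
  ext Q
  simp only [inducedCells, hset, mem_ofPred_eq, mem_range, mem_iUnion]
  constructor
  · rintro ⟨x, ⟨j, hj⟩, rfl⟩
    exact ⟨j, by rw [connectedComponentIn_chamber hj, h.closure_chamber]⟩
  · rintro ⟨j, rfl⟩
    obtain ⟨x, hx⟩ := h.chamber_nonempty j
    exact ⟨x, ⟨j, hx⟩, by rw [connectedComponentIn_chamber hx, h.closure_chamber]⟩

end cells

/-! ### The cells form a multi-split -/

lemma polyDim_add_card {n : ℕ} {κ : Type*} [DecidableEq κ] [Fintype κ] {p : Fin n → κ}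
    (hp : Function.Surjective p) {Q U : Set (Fin n → ℝ)} {x₀ : Fin n → ℝ} (hx₀ : x₀ ∈ U)
    (hU : IsOpen U) (hQ : ∀ x ∈ Q, x - x₀ ∈ fibreSumZero p)
    (hUQ : ∀ x ∈ U, x - x₀ ∈ fibreSumZero p → x ∈ Q) : polyDim Q + Fintype.card κ = n := by
  rw [polyDim, vectorSpan_eq_of_open hx₀ hU hQ hUQ, finrank_fibreSumZero hp]

section split

variable {n ℓ k : ℕ} [NeZero ℓ] {S : Fin ℓ → Finset (Fin n)} {s : Fin ℓ → ℤ}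

lemma IsDecoratedOSP.blockExcess_eq {k : ℤ} (h : IsDecoratedOSP k S s) {x : Fin n → ℝ}
    (hx : ∑ t, x t = k) (i : Fin ℓ) :
    blockExcess S s x i = height S s (i + 1) x - height S s i x := by
  have hd : ∑ i, blockExcess S s x i = 0 := by rw [h.sum_blockExcess, hx, sub_self]
  have h1 := cyclicSum_succ (d := blockExcess S s x) (i : ℕ)
  have h2 : cyclicSum (blockExcess S s x) (i + 1 : Fin ℓ) = cyclicSum (blockExcess S s x) (i + 1) := by
    rw [Fin.val_add, cyclicSum_mod hd, cyclicSum, cyclicSum, Finset.sum_range_add,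
      Finset.sum_range_succ]
    -- For ℓ = 1 the element `1 : Fin ℓ` has value 0, so the index does not advance; the only excess
    -- is then 0.
    rcases Nat.lt_or_ge 1 ℓ with hℓ | hℓ
    · simp [Nat.mod_eq_of_lt hℓ]
    · obtain rfl : ℓ = 1 := le_antisymm hℓ (NeZero.pos ℓ)
      have : blockExcess S s x (Fin.ofNat 1 i) = 0 := by
        rw [Fin.sum_univ_one] at hd
        rwa [Subsingleton.elim (Fin.ofNat 1 (i : ℕ)) 0]
      rw [this]
      simp
  rw [height, height, h2, h1]
  simp

lemma exists_height_functional (S : Fin ℓ → Finset (Fin n)) (s : Fin ℓ → ℤ) (j : Fin ℓ) :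
    ∃ l : (Fin n → ℝ) →L[ℝ] ℝ, ∀ x y, l x - l y = height S s j x - height S s j y := by
  refine ⟨∑ i ∈ Finset.range j, ∑ t ∈ S (Fin.ofNat ℓ i), ContinuousLinearMap.proj t, fun x y => ?_⟩
  simp [height, cyclicSum, blockExcess, coordSum, Finset.sum_sub_distrib]

/-- On cell i the difference h_i - h_j is at most 0, with equality exactly on cell j; its linear
part exposes the intersection. -/
lemma isExposed_cell_inter (i j : Fin ℓ) :
    IsExposed ℝ (cell k S s i) (cell k S s i ∩ cell k S s j) := by
  rintro ⟨z, hzi, hzj⟩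
  obtain ⟨li, hli⟩ := exists_height_functional S s i
  obtain ⟨lj, hlj⟩ := exists_height_functional S s j
  refine ⟨li - lj, ?_⟩
  ext x
  constructor
  · rintro ⟨hxi, hxj⟩
    refine ⟨hxi, fun y hy => ?_⟩
    have h1 := hli y x
    have h2 := hlj y x
    have h3 := hy.2 j
    have h4 := hxj.2 i
    simp only [FunLike.coe_sub, Pi.sub_apply]
    linarith
  · rintro ⟨hxi, hx⟩
    refine ⟨hxi, hxi.1, fun m => ?_⟩
    have h1 := hli z x
    have h2 := hlj z x
    have h3 := hx z hzi
    have h4 := hzi.2 j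
    have h5 := hzj.2 i
    have h6 := hxi.2 m
    simp only [FunLike.coe_sub, Pi.sub_apply] at h3
    linarith

lemma iUnion_cell : ⋃ j, cell k S s j = hypersimplex k n := by
  refine Subset.antisymm (iUnion_subset fun j x hx => hx.1) fun x hx => ?_
  obtain ⟨j, hj⟩ := Finite.exists_min fun j => height S s j x
  exact mem_iUnion.2 ⟨j, hx, hj⟩

/-- A cell is the hypersimplex cut by one rotated plate, whose sets are initial unions of blocks and
thus form a chain. -/
lemma IsDecoratedOSP.cell_eq_rankPolytope (h : IsDecoratedOSP (k : ℤ) S s) (j : Fin ℓ) :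
    cell k S s j = rankPolytope k (fun m : Fin ℓ => (Finset.Iio m).biUnion fun i => S (j + i))
      (fun m => ∑ i ∈ Finset.Iio m, s (j + i)) := by
  ext x
  refine and_congr_right fun hx => ?_
  have hk : ∑ t, x t = ((k : ℤ) : ℝ) := by exact_mod_cast hx.2
  constructor
  · intro hm m
    have h1 := h.coordSum_rotate_sub hk j m
    have h2 := hm (j + m)
    linarith
  · intro hm m
    have h1 := h.coordSum_rotate_sub hk j (m - j)
    have h2 := hm (m - j)
    rw [add_sub_cancel] at h1
    linarith

lemma IsHypersimplicialOSP.isMatroidPolytope_cell (h : IsHypersimplicialOSP (k : ℤ) S s)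
    (j : Fin ℓ) : IsMatroidPolytope (cell k S s j) := by
  have hne : (cell k S s j).Nonempty := (h.chamber_nonempty j).mono (chamber_subset_cell j)
  rw [h.cell_eq_rankPolytope] at hne ⊢
  refine isMatroidPolytope_rankPolytope (fun a b => ?_) hne
  rcases le_total a b with hab | hab
  · exact Or.inl (Finset.biUnion_subset_biUnion_of_subset_left _ (Finset.Iio_subset_Iio hab))
  · exact Or.inr (Finset.biUnion_subset_biUnion_of_subset_left _ (Finset.Iio_subset_Iio hab))

lemma IsHypersimplicialOSP.cell_subset_iff (h : IsHypersimplicialOSP (k : ℤ) S s) {i j : Fin ℓ} :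
    cell k S s i ⊆ cell k S s j ↔ i = j := by
  refine ⟨fun hsub => ?_, fun hij => hij ▸ Subset.rfl⟩
  by_contra hij
  obtain ⟨x, hx⟩ := h.chamber_nonempty i
  exact absurd ((hsub (chamber_subset_cell i hx)).2 i) (not_le.2 (hx.2 j (Ne.symm hij)))

lemma IsHypersimplicialOSP.cell_injective (h : IsHypersimplicialOSP (k : ℤ) S s) :
    Function.Injective (cell k S s) := fun _ _ hij => h.cell_subset_iff.1 hij.le

/-! ### Dimensions of the cells -/

lemma sub_mem_fibreSumZero_unit {x y : Fin n → ℝ} (hy : ∑ t, y t = (k : ℝ)) :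
    x - y ∈ fibreSumZero (fun _ : Fin n => ()) ↔ ∑ t, x t = (k : ℝ) := by
  simp [mem_fibreSumZero, hy, sub_eq_zero]

lemma polyDim_add_one_of_open {Q U : Set (Fin n → ℝ)} {x₀ : Fin n → ℝ} (hx₀ : x₀ ∈ U)
    (hn : 0 < n) (hx₀k : ∑ t, x₀ t = (k : ℝ)) (hU : IsOpen U) (hQ : ∀ x ∈ Q, ∑ t, x t = (k : ℝ))
    (hUQ : ∀ x ∈ U, ∑ t, x t = (k : ℝ) → x ∈ Q) : polyDim Q + 1 = n := by
  refine polyDim_add_card (p := fun _ : Fin n => ()) (fun _ => ⟨⟨0, hn⟩, rfl⟩) hx₀ hU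
    (fun x hx => (sub_mem_fibreSumZero_unit hx₀k).2 (hQ x hx)) fun x hx hxW =>
      hUQ x hx ((sub_mem_fibreSumZero_unit hx₀k).1 hxW)

lemma IsHypersimplicialOSP.pos (h : IsHypersimplicialOSP (k : ℤ) S s) : 0 < n :=
  let ⟨t, _⟩ := h.nonempty 0
  t.pos

lemma IsHypersimplicialOSP.polyDim_hypersimplex (h : IsHypersimplicialOSP (k : ℤ) S s) :
    polyDim (hypersimplex k n) + 1 = n := by
  obtain ⟨x₀, hx₀⟩ := h.openHypersimplex_nonempty
  exact polyDim_add_one_of_open (U := openCube n) hx₀.1 h.pos hx₀.2 (isOpen_openCube n)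
    (fun x hx => hx.2) fun x hx hxk => openHypersimplex_subset k n ⟨hx, hxk⟩

lemma isOpen_height_lt (A : Set (Fin ℓ)) (i : Fin ℓ) :
    IsOpen {x : Fin n → ℝ | ∀ m ∈ A, height S s i x < height S s m x} := by
  simp only [ofPred_forall]
  exact isOpen_iInter_of_finite fun m => isOpen_iInter_of_finite fun _ =>
    isOpen_lt (continuous_height i) (continuous_height m)

lemma IsHypersimplicialOSP.polyDim_cell (h : IsHypersimplicialOSP (k : ℤ) S s) (j : Fin ℓ) :
    polyDim (cell k S s j) + 1 = n := by
  obtain ⟨x₀, hx₀⟩ := h.chamber_nonempty j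
  exact polyDim_add_one_of_open (U := openCube n ∩ _) ⟨hx₀.1.1, hx₀.2⟩ h.pos hx₀.1.2
    ((isOpen_openCube n).inter (isOpen_height_lt {j}ᶜ j))
    (fun x hx => hx.1.2) fun x hx hxk => chamber_subset_cell j ⟨⟨hx.1, hxk⟩, hx.2⟩

lemma height_sub_height (hS : ∀ i j, i ≠ j → Disjoint (S i) (S j)) {β : Fin n → Fin ℓ}
    (hβ : ∀ t, t ∈ S (β t)) (j : Fin ℓ) (x y : Fin n → ℝ) :
    height S s j x - height S s j y = ∑ t with β t < j, (x - y) t := by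
  have h1 : (Finset.univ.filter fun t => β t < j) = (Finset.Iio j).biUnion S := by
    ext t
    simp only [Finset.mem_filter, Finset.mem_univ, true_and, Finset.mem_biUnion, Finset.mem_Iio]
    refine ⟨fun h => ⟨_, h, hβ t⟩, ?_⟩
    rintro ⟨i, hi, ht⟩
    by_cases he : β t = i
    · exact he ▸ hi
    · exact absurd ht (Finset.disjoint_left.1 (hS _ _ he) (hβ t))
  have h2 := coordSum_biUnion hS (Finset.Iio j) (e := id) Function.injective_id (x - y)
  simp only [id] at h2
  rw [height, height, cyclicSum_eq_sum_Iio, cyclicSum_eq_sum_Iio, h1]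
  refine Eq.trans ?_ h2.symm
  rw [← Finset.sum_sub_distrib]
  simp [blockExcess, coordSum_sub]

lemma IsHypersimplicialOSP.polyDim_cell_inter (h : IsHypersimplicialOSP (k : ℤ) S s)
    {i j : Fin ℓ} (hij : i < j) :
    (cell k S s i ∩ cell k S s j).Nonempty ∧ polyDim (cell k S s i ∩ cell k S s j) + 2 = n := by
  -- A point whose minimal height is attained exactly at i and j.
  obtain ⟨x₀, hx₀, hg⟩ := h.exists_height_eq
    (g := fun m => if m = i ∨ m = j then -(1 / 4) else 0)
    (fun i => by split_ifs <;> norm_num [abs_of_pos])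
  have h0 : height S s j x₀ = height S s i x₀ := by simp [hg]
  have hlt : ∀ m ∈ ({i, j}ᶜ : Set (Fin ℓ)), height S s i x₀ < height S s m x₀ := by
    intro m hm
    simp only [mem_compl_iff, mem_insert_iff, mem_singleton_iff] at hm
    rw [hg, hg]
    simp only [hm, if_false, true_or, if_true]
    linarith
  have hmem : ∀ x ∈ hypersimplex k n, height S s j x = height S s i x →
      (∀ m ∈ ({i, j}ᶜ : Set (Fin ℓ)), height S s i x < height S s m x) →
      x ∈ cell k S s i ∩ cell k S s j := by
    intro x hx he hm
    have hi : ∀ m, height S s i x ≤ height S s m x := by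
      intro m
      by_cases hm' : m ∈ ({i, j}ᶜ : Set (Fin ℓ))
      · exact (hm m hm').le
      · simp only [mem_compl_iff, mem_insert_iff, mem_singleton_iff, not_not] at hm'
        rcases hm' with rfl | rfl
        · exact le_rfl
        · exact he.ge
    exact ⟨⟨hx, hi⟩, hx, fun m => he ▸ hi m⟩
  refine ⟨⟨x₀, hmem x₀ (openHypersimplex_subset k n hx₀) h0 hlt⟩, ?_⟩
  choose β hβ using h.cover
  have hβ' : ∀ i t, t ∈ S i → β t = i := fun i t ht => by
    by_contra hne
    exact Finset.disjoint_left.1 (h.disjoint _ _ hne) (hβ t) ht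
  -- Equality of the heights i and j fixes the sum over the blocks i, …, j - 1. With the total
  -- fixed, this means two fibre sums, whence codimension 2 in ℝⁿ.
  have hW : ∀ x : Fin n → ℝ, x - x₀ ∈ fibreSumZero (fun t => decide (i ≤ β t ∧ β t < j)) ↔
      ∑ t, x t = (k : ℝ) ∧ height S s j x = height S s i x := by
    intro x
    have h1 := height_sub_height (s := s) h.disjoint hβ j x x₀
    have h2 := height_sub_height (s := s) h.disjoint hβ i x x₀
    have h3 : ∑ t with β t < j, (x - x₀) t = ∑ t with β t < i, (x - x₀) t
        + ∑ t with (i ≤ β t ∧ β t < j), (x - x₀) t := by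
      rw [← Finset.sum_filter_add_sum_filter_not (Finset.univ.filter fun t => β t < j)
        (fun t => β t < i), Finset.filter_filter, Finset.filter_filter]
      congr 2
      · ext t
        simp only [Finset.mem_filter, Finset.mem_univ, true_and]
        exact ⟨fun h => h.2, fun h => ⟨h.trans hij, h⟩⟩
      · ext t
        simp only [Finset.mem_filter, Finset.mem_univ, true_and, not_lt]
        tauto
    have h4 := Finset.sum_filter_add_sum_filter_not Finset.univ
      (fun t => i ≤ β t ∧ β t < j) (fun t => (x - x₀) t)
    have h5 : ∑ t, (x - x₀) t = ∑ t, x t - k := by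
      simp [Finset.sum_sub_distrib, hx₀.2]
    simp only [mem_fibreSumZero, Bool.forall_bool, decide_eq_true_eq, decide_eq_false_iff_not]
    constructor
    · rintro ⟨ha, hb⟩
      constructor <;> linarith
    · rintro ⟨ha, hb⟩
      constructor <;> linarith
  refine polyDim_add_card (κ := Bool) (p := fun t => decide (i ≤ β t ∧ β t < j)) ?_
    (U := openCube n ∩
      {x | ∀ m ∈ ({i, j}ᶜ : Set (Fin ℓ)), height S s i x < height S s m x}) (x₀ := x₀) ⟨hx₀.1, hlt⟩
    ((isOpen_openCube n).inter (isOpen_height_lt {i, j}ᶜ i)) ?_ ?_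
  · rintro (_ | _)
    · obtain ⟨t, ht⟩ := h.nonempty j
      exact ⟨t, by simp [hβ' j t ht]⟩
    · obtain ⟨t, ht⟩ := h.nonempty i
      exact ⟨t, by simp [hβ' i t ht, hij]⟩
  · intro x hx
    exact (hW x).2 ⟨hx.1.1.2, le_antisymm (hx.2.2 i) (hx.1.2 j)⟩
  · intro x hx hxW
    obtain ⟨hxk, he⟩ := (hW x).1 hxW
    exact hmem x (openHypersimplex_subset k n ⟨hx.1, hxk⟩) he hx.2

/-- All heights agree exactly when every block excess vanishes, which gives ℓ independent equations.
-/
lemma IsHypersimplicialOSP.polyDim_iInter_cell (h : IsHypersimplicialOSP (k : ℤ) S s) :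
    (⋂ j, cell k S s j).Nonempty ∧ polyDim (⋂ j, cell k S s j) + ℓ = n := by
  obtain ⟨x₀, hx₀, hg⟩ := h.exists_height_eq (g := fun _ => 0) (by norm_num)
  simp only [sub_self] at hg
  choose β hβ using h.cover
  have hβ' : ∀ i, (Finset.univ.filter fun t => β t = i) = S i := fun i => by
    ext t
    simp only [Finset.mem_filter, Finset.mem_univ, true_and]
    refine ⟨fun he => he ▸ hβ t, fun ht => ?_⟩
    by_contra hne
    exact Finset.disjoint_left.1 (h.disjoint _ _ hne) (hβ t) ht
  have hk : ∀ {x : Fin n → ℝ}, ∑ t, x t = (k : ℝ) → ∑ t, x t = ((k : ℤ) : ℝ) := by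
    intro x hx; exact_mod_cast hx
  have hb₀ : ∀ i, blockExcess S s x₀ i = 0 := fun i => by
    rw [h.blockExcess_eq (hk hx₀.2), hg, hg, sub_self]
  have hW : ∀ x : Fin n → ℝ, x - x₀ ∈ fibreSumZero β ↔ ∀ i, blockExcess S s x i = 0 := by
    intro x
    rw [mem_fibreSumZero]
    refine forall_congr' fun i => ?_
    rw [hβ' i]
    have h1 := coordSum_sub x x₀ (S i)
    have h2 := hb₀ i
    unfold blockExcess at h2 ⊢
    unfold coordSum at *
    constructor <;> intro h3 <;> linarith
  have hmem : ∀ x ∈ hypersimplex k n, (∀ i, blockExcess S s x i = 0) → x ∈ ⋂ j, cell k S s j := by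
    intro x hx hb
    have : ∀ j, height S s j x = 0 := fun j => by simp [height, cyclicSum, hb]
    exact mem_iInter.2 fun j => ⟨hx, fun m => by rw [this, this]⟩
  refine ⟨⟨x₀, hmem x₀ (openHypersimplex_subset k n hx₀) hb₀⟩, ?_⟩
  have key := polyDim_add_card (p := β) (Q := ⋂ j, cell k S s j) (U := openCube n) (fun i => ?_) hx₀.1
    (isOpen_openCube n) ?_ ?_
  · simpa using key
  · obtain ⟨t, ht⟩ := h.nonempty i
    rw [← hβ' i, Finset.mem_filter] at ht
    exact ⟨t, ht.2⟩
  · intro x hx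
    rw [mem_iInter] at hx
    refine (hW x).2 fun i => ?_
    rw [h.blockExcess_eq (hk (hx 0).1.2), sub_eq_zero]
    exact le_antisymm ((hx _).2 _) ((hx _).2 _)
  · intro x hx hxW
    have hb := (hW x).1 hxW
    have h1 := h.sum_blockExcess x
    simp only [hb, Finset.sum_const_zero] at h1
    have h2 : ∑ t, x t = (k : ℝ) := by push_cast at h1; linarith
    exact hmem x (openHypersimplex_subset k n ⟨hx, h2⟩) hb

/-! ### The multi-split -/

lemma IsHypersimplicialOSP.isSubdivision (h : IsHypersimplicialOSP (k : ℤ) S s) :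
    IsSubdivision (hypersimplex k n) (range (cell k S s)) where
  finite := finite_range _
  polytope := by
    rintro _ ⟨j, rfl⟩
    exact (h.isMatroidPolytope_cell j).isPolytope
  nonempty := by
    rintro _ ⟨j, rfl⟩
    exact (h.chamber_nonempty j).mono (chamber_subset_cell j)
  dim_eq := by
    rintro _ ⟨j, rfl⟩
    have h1 := h.polyDim_cell j
    have h2 := h.polyDim_hypersimplex
    omega
  cover := by rw [sUnion_range, iUnion_cell]
  face_inter := by
    rintro _ ⟨i, rfl⟩ _ ⟨j, rfl⟩
    exact ⟨isExposed_cell_inter i j, inter_comm (cell k S s i) _ ▸ isExposed_cell_inter j i⟩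

/-- A convex union of at least two cells contains all of them. -/
lemma IsHypersimplicialOSP.cell_subset_of_convex (h : IsHypersimplicialOSP (k : ℤ) S s)
    {R : Set (Fin n → ℝ)} (hR : Convex ℝ R) (hRu : R = ⋃₀ {Q ∈ range (cell k S s) | Q ⊆ R})
    {i j : Fin ℓ} (hij : i ≠ j) (hi : cell k S s i ⊆ R) (hj : cell k S s j ⊆ R) (m : Fin ℓ) :
    cell k S s m ⊆ R := by
  by_contra hm
  have hmi : m ≠ i := fun he => hm (he ▸ hi)
  have hmj : m ≠ j := fun he => hm (he ▸ hj)
  -- Lowest height at a, second lowest at m. For the midpoint of the points for i and j, up to a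
  -- common shift, the heights i and j are -3/32, height m is -4/32 and the rest are 0, so it lies
  -- in cell m only.
  have hpt : ∀ a : Fin ℓ, a ≠ m → ∃ x ∈ cell k S s a, ∀ b, height S s b x =
      (if b = a then -(3 / 16) else if b = m then -(2 / 16) else 0)
        - (if 0 = a then -(3 / 16) else if 0 = m then -(2 / 16) else 0) := by
    intro a ha
    obtain ⟨x, hx, hg⟩ := h.exists_height_eq
      (g := fun b => if b = a then -(3 / 16) else if b = m then -(2 / 16) else 0)
      (fun b => by split_ifs <;> norm_num [abs_of_pos])
    refine ⟨x, ⟨openHypersimplex_subset k n hx, fun b => ?_⟩, hg⟩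
    rw [hg, hg, if_pos rfl]
    refine sub_le_sub_right ?_ _
    split_ifs <;> norm_num
  obtain ⟨x, hx, hgx⟩ := hpt i hmi.symm
  obtain ⟨y, hy, hgy⟩ := hpt j hmj.symm
  have hz : (1 / 2 : ℝ) • x + (1 / 2 : ℝ) • y ∈ R :=
    hR (hi hx) (hj hy) (by norm_num) (by norm_num) (by norm_num)
  rw [hRu] at hz
  obtain ⟨_, ⟨⟨a, rfl⟩, haR⟩, hza⟩ := hz
  have ham : a ≠ m := fun he => hm (he ▸ haR)
  have h1 := hza.2 m
  rw [height_combo (by norm_num), height_combo (by norm_num), hgx, hgx, hgy, hgy, if_neg hmi,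
    if_neg hmj, if_pos rfl, if_neg ham] at h1
  by_cases hai : a = i
  · rw [if_pos hai, if_neg (fun he => hij (hai.symm.trans he))] at h1
    linarith
  · rw [if_neg hai] at h1
    split_ifs at h1 <;> linarith

/-- Coarse cells are convex unions of cells. One containing two cells is the whole hypersimplex;
otherwise each contains a single cell. -/
lemma IsHypersimplicialOSP.isCoarsest (h : IsHypersimplicialOSP (k : ℤ) S s) :
    IsCoarsest (hypersimplex k n) (range (cell k S s)) := by
  intro 𝒯 h𝒯 href
  have hun := fun R (hR : R ∈ 𝒯) => h.isSubdivision.eq_sUnion_of_refines h𝒯 href hR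
  by_cases hex : ∃ R ∈ 𝒯, ∃ i j, i ≠ j ∧ cell k S s i ⊆ R ∧ cell k S s j ⊆ R
  · right
    obtain ⟨R, hR, i, j, hij, hi, hj⟩ := hex
    have hRP : R = hypersimplex k n := by
      refine Subset.antisymm (h𝒯.cover ▸ subset_sUnion_of_mem hR) ?_
      rw [← iUnion_cell (S := S) (s := s)]
      exact iUnion_subset
        (h.cell_subset_of_convex (h𝒯.polytope R hR).convex (hun R hR) hij hi hj)
    refine Subset.antisymm (fun R' hR' => ?_) (by rw [← hRP]; simpa using hR)
    have hsub : R' ⊆ R := by rw [hRP, ← h𝒯.cover]; exact subset_sUnion_of_mem hR'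
    rw [mem_singleton_iff, ← hRP]
    exact h𝒯.eq_of_subset hR' hR hsub
  · left
    push Not at hex
    have hcell : ∀ R ∈ 𝒯, ∀ i, cell k S s i ⊆ R → R = cell k S s i := by
      intro R hR i hi
      refine Subset.antisymm ?_ hi
      rw [hun R hR]
      rintro x ⟨_, ⟨⟨j, rfl⟩, hjR⟩, hx⟩
      by_cases hij : i = j
      · exact hij ▸ hx
      · exact absurd hjR (hex R hR i j hij hi)
    refine Subset.antisymm (fun R hR => ?_) ?_
    · obtain ⟨x, hx⟩ := h𝒯.nonempty R hR
      rw [hun R hR] at hx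
      obtain ⟨_, ⟨⟨j, rfl⟩, hjR⟩, -⟩ := hx
      exact ⟨j, (hcell R hR j hjR).symm⟩
    · rintro _ ⟨j, rfl⟩
      obtain ⟨R, hR, hjR⟩ := href _ ⟨j, rfl⟩
      exact hcell R hR j hjR ▸ hR

lemma IsHypersimplicialOSP.ncard_range_cell (h : IsHypersimplicialOSP (k : ℤ) S s) :
    (range (cell k S s)).ncard = ℓ := by
  rw [← image_univ, ncard_image_of_injective _ h.cell_injective, ncard_univ, Nat.card_fin]

lemma IsHypersimplicialOSP.isSplit (h : IsHypersimplicialOSP (k : ℤ) S s) :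
    IsSplit ℓ (hypersimplex k n) (range (cell k S s)) where
  one_le := NeZero.one_le
  subdivision := h.isSubdivision
  coarsest := h.isCoarsest
  ncard_eq := h.ncard_range_cell
  facet_inter := by
    have h2 := h.polyDim_hypersimplex
    rintro _ ⟨i, rfl⟩ _ ⟨j, rfl⟩ hij
    rcases lt_trichotomy i j with hlt | rfl | hlt
    · obtain ⟨h3, h4⟩ := h.polyDim_cell_inter hlt
      exact ⟨h3, by omega⟩
    · exact absurd rfl hij
    · obtain ⟨h3, h4⟩ := h.polyDim_cell_inter hlt
      rw [inter_comm] at h3 h4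
      exact ⟨h3, by omega⟩
  inter_nonempty := by
    rw [sInter_range]
    exact h.polyDim_iInter_cell.1
  codim_inter := by
    rw [sInter_range]
    have h1 := h.polyDim_iInter_cell.2
    have h2 := h.polyDim_hypersimplex
    have h3 : 1 ≤ ℓ := NeZero.one_le
    omega

end split

/-! ### Arcs -/

section arcs

variable {n : ℕ} [NeZero n] {σ : Equiv.Perm (Fin n)}

lemma mem_arc {a b : ℕ} {x : Fin n} : x ∈ arc σ a b ↔ ∃ t, a ≤ t ∧ t < b ∧ σ (Fin.ofNat n t) = x := by
  simp [arc, and_assoc]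

lemma ofNat_eq_ofNat {t u : ℕ} : Fin.ofNat n t = Fin.ofNat n u ↔ t ≡ u [MOD n] := by
  rw [Fin.ext_iff]
  rfl

lemma ofNat_add_card (t : ℕ) : Fin.ofNat n (t + n) = Fin.ofNat n t := by
  ext; simp

lemma eq_of_ofNat_eq {c t u : ℕ} (ht : c ≤ t) (ht' : t < c + n) (hu : c ≤ u) (hu' : u < c + n)
    (h : Fin.ofNat n t = Fin.ofNat n u) : t = u := by
  wlog htu : t ≤ u generalizing t u
  · exact (this hu hu' ht ht' h.symm (le_of_not_ge htu)).symm
  have h1 := (Nat.modEq_iff_dvd' htu).1 (ofNat_eq_ofNat.1 h)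
  have h2 := Nat.eq_zero_of_dvd_of_lt h1 (by omega)
  omega

lemma exists_modEq (c t : ℕ) : ∃ u, c ≤ u ∧ u < c + n ∧ Fin.ofNat n u = Fin.ofNat n t := by
  have hn : 0 < n := NeZero.pos n
  -- Adding n * c keeps the truncated subtraction honest without changing the residue.
  refine ⟨c + (t + n * c - c) % n, by omega, by have := Nat.mod_lt (t + n * c - c) hn; omega, ?_⟩
  have h1 : c ≤ n * c := Nat.le_mul_of_pos_left c hn
  rw [ofNat_eq_ofNat, Nat.ModEq, Nat.add_mod_mod,
    show c + (t + n * c - c) = t + n * c by omega, Nat.add_mul_mod_self_left]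

lemma sum_arc {M : Type*} [AddCommMonoid M] (f : Fin n → M) {a b : ℕ} (hb : b ≤ a + n) :
    ∑ x ∈ arc σ a b, f x = ∑ t ∈ Finset.Ico a b, f (σ (Fin.ofNat n t)) := by
  rw [arc, Finset.sum_image]
  intro t ht u hu h
  simp only [Finset.coe_Ico, mem_Ico] at ht hu
  exact eq_of_ofNat_eq (c := a) ht.1 (by omega) hu.1 (by omega) (σ.injective h)

lemma arc_union {a b c : ℕ} (hab : a ≤ b) (hbc : b ≤ c) :
    arc σ a b ∪ arc σ b c = arc σ a c := by
  rw [arc, arc, arc, ← Finset.image_union, Finset.Ico_union_Ico_eq_Ico hab hbc]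

lemma arc_nonempty {a b : ℕ} (hab : a < b) : (arc σ a b).Nonempty :=
  ⟨_, mem_arc.2 ⟨a, le_rfl, hab, rfl⟩⟩

end arcs

/-! ### Cyclic decompositions -/

lemma exists_castSucc_le_lt_succ {ℓ : ℕ} (a : Fin (ℓ + 1) → ℕ) {t : ℕ} (h0 : a 0 ≤ t)
    (h1 : t < a (Fin.last ℓ)) : ∃ j : Fin ℓ, a j.castSucc ≤ t ∧ t < a j.succ := by
  by_contra! hcon
  have : ∀ j, a j ≤ t := fun j => Fin.induction h0 hcon j
  exact absurd (this (Fin.last ℓ)) (not_le.2 h1)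

namespace CyclicDecomposition

variable {n : ℕ} [NeZero n] {σ : Equiv.Perm (Fin n)} {I : Finset (Fin n)} {ℓ : ℕ}
  (D : CyclicDecomposition σ I ℓ)

lemma strictMono_a : StrictMono D.a :=
  Fin.strictMono_iff_lt_succ.2 fun j => (D.a_lt_b j).trans (D.b_lt_a j)

lemma pos (D : CyclicDecomposition σ I ℓ) : 0 < ℓ := by
  rcases Nat.eq_zero_or_pos ℓ with h | h
  · subst h
    have h1 := D.a_last
    have h2 : D.a (Fin.last 0) = D.a 0 := rfl
    have := NeZero.pos n
    omega
  · exact h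

lemma a_zero_le (i : Fin (ℓ + 1)) : D.a 0 ≤ D.a i := D.strictMono_a.monotone (Fin.zero_le i)

lemma a_le (i : Fin (ℓ + 1)) : D.a i ≤ D.a 0 + n :=
  D.a_last ▸ D.strictMono_a.monotone (Fin.le_last i)

lemma S_eq_arc (j : Fin ℓ) : D.S j = arc σ (D.a j.castSucc) (D.a j.succ) := by
  rw [S, Finset.union_comm]
  exact arc_union (D.a_lt_b j).le (D.b_lt_a j).le

lemma locate (t : ℕ) : ∃ (j : Fin ℓ) (u : ℕ), Fin.ofNat n u = Fin.ofNat n t ∧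
    D.a j.castSucc ≤ u ∧ u < D.a j.succ := by
  obtain ⟨u, h1, h2, h3⟩ := exists_modEq (n := n) (D.a 0) t
  obtain ⟨j, hj⟩ := exists_castSucc_le_lt_succ D.a h1 (D.a_last ▸ h2)
  exact ⟨j, u, h3, hj⟩

lemma disjoint_S {i j : Fin ℓ} (hij : i ≠ j) : Disjoint (D.S i) (D.S j) := by
  wlog hlt : i < j generalizing i j
  · exact (this hij.symm (lt_of_le_of_ne (not_lt.1 hlt) hij.symm)).symm
  rw [D.S_eq_arc, D.S_eq_arc, Finset.disjoint_left]
  intro x hx hx'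
  obtain ⟨t, ht, ht', rfl⟩ := mem_arc.1 hx
  obtain ⟨u, hu, hu', hut⟩ := mem_arc.1 hx'
  have h1 := D.a_zero_le i.castSucc
  have h2 := D.a_zero_le j.castSucc
  have h3 := D.a_le i.succ
  have h4 := D.a_le j.succ
  have h5 := eq_of_ofNat_eq (c := D.a 0) (by omega) (by omega) (by omega) (by omega)
    (σ.injective hut)
  have h6 : D.a i.succ ≤ D.a j.castSucc := D.strictMono_a.monotone (by
    rw [Fin.le_def, Fin.val_succ, Fin.val_castSucc]; exact hlt)
  omega

lemma mem_S (x : Fin n) : ∃ j, x ∈ D.S j := by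
  obtain ⟨j, u, hu, h1, h2⟩ := D.locate (σ.symm x : ℕ)
  refine ⟨j, ?_⟩
  rw [D.S_eq_arc]
  exact mem_arc.2 ⟨u, h1, h2, by rw [hu]; simp⟩

lemma I'_subset_S (j : Fin ℓ) : D.I' j ⊆ D.S j := Finset.subset_union_left

lemma I'_nonempty (j : Fin ℓ) : (D.I' j).Nonempty := arc_nonempty (D.b_lt_a j)

lemma disjoint_I' {i j : Fin ℓ} (hij : i ≠ j) : Disjoint (D.I' i) (D.I' j) :=
  (D.disjoint_S hij).mono (D.I'_subset_S i) (D.I'_subset_S j)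

lemma I'_injective : Function.Injective D.I' := by
  intro i j hij
  by_contra hne
  have := D.disjoint_I' hne
  rw [hij, disjoint_self] at this
  exact (D.I'_nonempty j).ne_empty this

lemma exists_mem_I' {x : Fin n} (hx : x ∈ I) : ∃ j, x ∈ D.I' j := by
  obtain ⟨j, hj⟩ := D.mem_S x
  rcases Finset.mem_union.1 hj with h | h
  · exact ⟨j, h⟩
  · exact absurd hx (Finset.disjoint_left.1 (D.compl_run j) h)

lemma inter_S (j : Fin ℓ) : I ∩ D.S j = D.I' j := by
  ext x
  rw [Finset.mem_inter, S, Finset.mem_union]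
  refine ⟨fun h => h.2.resolve_right fun hC => Finset.disjoint_left.1 (D.compl_run j) hC h.1,
    fun h => ⟨D.run j h, Or.inl h⟩⟩

lemma biUnion_I' : Finset.univ.biUnion D.I' = I := by
  ext x
  simp only [Finset.mem_biUnion, Finset.mem_univ, true_and]
  exact ⟨fun ⟨j, hj⟩ => D.run j hj, D.exists_mem_I'⟩

lemma isHypersimplicialOSP : IsHypersimplicialOSP (I.card : ℤ) D.S D.s where
  nonempty j := (D.I'_nonempty j).mono (D.I'_subset_S j)
  disjoint i j := D.disjoint_S
  cover := D.mem_S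
  sum_eq := by
    simp only [s]
    rw [← Nat.cast_sum, ← Finset.card_biUnion fun i _ j _ hij => D.disjoint_I' hij, D.biUnion_I']
  one_le j := by
    have := Finset.card_pos.2 (D.I'_nonempty j)
    rw [s]
    omega
  le_card_sub_one j := by
    have h1 : Disjoint (D.I' j) (D.C j) := ((D.compl_run j).symm.mono_left (D.run j))
    have h2 : 0 < (D.C j).card := Finset.card_pos.2 (arc_nonempty (D.a_lt_b j))
    rw [s, S, Finset.card_union_of_disjoint h1]
    omega

lemma exists_castSucc_ofNat_eq (i : Fin (ℓ + 1)) :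
    ∃ j : Fin ℓ, Fin.ofNat n (D.a j.castSucc) = Fin.ofNat n (D.a i) := by
  rcases Fin.eq_castSucc_or_eq_last i with ⟨j, rfl⟩ | rfl
  · exact ⟨j, rfl⟩
  · refine ⟨⟨0, D.pos⟩, ?_⟩
    rw [D.a_last, ofNat_add_card]
    rfl

lemma notMem_a (i : Fin (ℓ + 1)) : σ (Fin.ofNat n (D.a i)) ∉ I := by
  obtain ⟨j, hj⟩ := D.exists_castSucc_ofNat_eq i
  rw [← hj]
  exact Finset.disjoint_left.1 (D.compl_run j) (mem_arc.2 ⟨_, le_rfl, D.a_lt_b j, rfl⟩)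

/-- Every cyclic interval in `I` lies in one of the runs of the decomposition. -/
lemma exists_arc_subset_I' {a b : ℕ} (hab : a < b) (h : arc σ a b ⊆ I) :
    ∃ j, arc σ a b ⊆ D.I' j := by
  induction b, hab using Nat.le_induction with
  | base =>
    obtain ⟨j, hj⟩ := D.exists_mem_I' (h (mem_arc.2 ⟨a, le_rfl, Nat.lt_succ_self a, rfl⟩))
    refine ⟨j, fun x hx => ?_⟩
    obtain ⟨t, h1, h2, rfl⟩ := mem_arc.1 hx
    obtain rfl : t = a := by omega
    exact hj
  | succ b hab ih =>
    have hu : arc σ a b ∪ arc σ b (b + 1) = arc σ a (b + 1) := arc_union (by omega) (by omega)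
    obtain ⟨j, hj⟩ := ih ((hu ▸ Finset.subset_union_left).trans h)
    refine ⟨j, ?_⟩
    rw [← hu]
    refine Finset.union_subset hj fun x hx => ?_
    obtain ⟨t, h1, h2, rfl⟩ := mem_arc.1 hx
    obtain rfl : t = b := by omega
    have hlast : σ (Fin.ofNat n (t - 1)) ∈ D.I' j :=
      hj (mem_arc.2 ⟨t - 1, by omega, by omega, rfl⟩)
    obtain ⟨u, hu1, hu2, hu3⟩ := mem_arc.1 hlast
    have hnext : Fin.ofNat n (u + 1) = Fin.ofNat n t := by
      have := (ofNat_eq_ofNat.1 (σ.injective hu3)).add_right 1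
      rw [show t - 1 + 1 = t by omega] at this
      exact ofNat_eq_ofNat.2 this
    rcases Nat.lt_or_ge (u + 1) (D.a j.succ) with hlt | hge
    · exact mem_arc.2 ⟨u + 1, by omega, hlt, by rw [hnext]⟩
    -- Stepping past the end of a run of I lands on the start of the next C, outside I.
    · have he : u + 1 = D.a j.succ := by omega
      have hI := h (mem_arc.2 ⟨t, by omega, by omega, rfl⟩)
      rw [← hnext, he] at hI
      exact absurd hI (D.notMem_a _)

lemma isCyclicInterval_I' (j : Fin ℓ) : IsCyclicInterval σ (D.I' j) := by
  refine ⟨_, _, D.b_lt_a j, ?_, rfl⟩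
  have h1 := D.a_le j.succ
  have h2 := D.a_zero_le j.castSucc
  have h3 := D.a_lt_b j
  omega

lemma numCyclicIntervals_eq (D : CyclicDecomposition σ I ℓ) : numCyclicIntervals σ I = ℓ := by
  have hset : {J : Finset (Fin n) | Maximal (fun J => IsCyclicInterval σ J ∧ J ⊆ I) J}
      = range D.I' := by
    ext J
    rw [mem_ofPred_eq, mem_range]
    constructor
    · rintro ⟨⟨⟨a, b, hab, -, rfl⟩, hJI⟩, hmax⟩
      obtain ⟨j, hj⟩ := D.exists_arc_subset_I' hab hJI
      exact ⟨j, Finset.Subset.antisymm (hmax ⟨D.isCyclicInterval_I' j, D.run j⟩ hj) hj⟩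
    · rintro ⟨j, rfl⟩
      refine ⟨⟨D.isCyclicInterval_I' j, D.run j⟩, ?_⟩
      rintro J ⟨⟨a, b, hab, -, rfl⟩, hJI⟩ hle
      obtain ⟨i, hi⟩ := D.exists_arc_subset_I' hab hJI
      obtain ⟨x, hx⟩ := D.I'_nonempty j
      by_cases hij : i = j
      · exact hij ▸ hi
      · exact absurd hx (Finset.disjoint_left.1 (D.disjoint_I' hij) (hi (hle hx)))
  rw [numCyclicIntervals, hset, ← image_univ, ncard_image_of_injective _ D.I'_injective,
    ncard_univ, Nat.card_fin]

lemma isCyclicInterval_iff (D : CyclicDecomposition σ I ℓ) : IsCyclicInterval σ I ↔ ℓ = 1 := by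
  constructor
  · rintro ⟨a, b, hab, -, hI⟩
    obtain ⟨j, hj⟩ := D.exists_arc_subset_I' hab hI.ge
    rw [← hI] at hj
    have hall : ∀ i, i = j := by
      intro i
      by_contra hij
      obtain ⟨x, hx⟩ := D.I'_nonempty i
      exact Finset.disjoint_left.1 (D.disjoint_I' hij) hx (hj (D.run i hx))
    have : Subsingleton (Fin ℓ) := ⟨fun x y => (hall x).trans (hall y).symm⟩
    have h1 := Fin.subsingleton_iff_le_one.1 this
    have h2 := D.pos
    omega
  · rintro rfl
    have h := D.isCyclicInterval_I' 0
    have hI := D.biUnion_I'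
    rw [Finset.univ_unique, Finset.singleton_biUnion] at hI
    rwa [show D.I' 0 = I from hI] at h

end CyclicDecomposition

/-! ### Existence of cyclic decompositions -/

/-- Peel off a maximal stretch without p and the following stretch with p, then recurse; N only
bounds the length of the interval. -/
lemma exists_runs (p : ℕ → Prop) (N : ℕ) : ∀ u v : ℕ, v - u ≤ N → u ≤ v →
    (u < v → ¬ p u ∧ p (v - 1)) → ∃ (ℓ : ℕ) (a : Fin (ℓ + 1) → ℕ) (b : Fin ℓ → ℕ),
      a 0 = u ∧ a (Fin.last ℓ) = v ∧ (∀ j, a j.castSucc < b j) ∧ (∀ j, b j < a j.succ) ∧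
      (∀ j t, a j.castSucc ≤ t → t < b j → ¬ p t) ∧ (∀ j t, b j ≤ t → t < a j.succ → p t) := by
  classical
  induction N with
  | zero =>
    intro u v h1 h2 _
    obtain rfl : u = v := by omega
    exact ⟨0, fun _ => u, Fin.elim0, rfl, rfl, fun j => j.elim0, fun j => j.elim0,
      fun j => j.elim0, fun j => j.elim0⟩
  | succ N ih =>
    intro u v h1 h2 h3
    rcases h2.eq_or_lt with rfl | hlt
    · exact ih u u (by omega) le_rfl h3
    obtain ⟨hu, hv⟩ := h3 hlt
    have hb : ∃ t, u ≤ t ∧ p t := ⟨v - 1, by omega, hv⟩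
    obtain ⟨hub, hpb⟩ := Nat.find_spec hb
    have hbmin : ∀ t, u ≤ t → t < Nat.find hb → ¬ p t := fun t h4 h5 h6 =>
      Nat.find_min hb h5 ⟨h4, h6⟩
    have hbv : Nat.find hb ≤ v - 1 := Nat.find_min' hb ⟨by omega, hv⟩
    set b₀ := Nat.find hb
    have hub' : u < b₀ := lt_of_le_of_ne hub fun h => hu (h ▸ hpb)
    have hc : ∃ t, b₀ ≤ t ∧ (¬ p t ∨ t = v) := ⟨v, by omega, Or.inr rfl⟩
    obtain ⟨hbc, hpc⟩ := Nat.find_spec hc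
    have hcmin : ∀ t, b₀ ≤ t → t < Nat.find hc → p t := fun t h4 h5 => by
      by_contra h6
      exact Nat.find_min hc h5 ⟨h4, Or.inl h6⟩
    have hcv : Nat.find hc ≤ v := Nat.find_min' hc ⟨by omega, Or.inr rfl⟩
    set c := Nat.find hc
    have hbc' : b₀ < c := lt_of_le_of_ne hbc fun h => by
      rcases hpc with h' | h'
      · exact h' (h ▸ hpb)
      · omega
    obtain ⟨ℓ, a, b, ha0, hal, h4, h5, h6, h7⟩ := ih c v (by omega) hcv
      fun hlt' => ⟨hpc.resolve_right hlt'.ne, hv⟩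
    refine ⟨ℓ + 1, Fin.cons u a, Fin.cons b₀ b, rfl, ?_, ?_, ?_, ?_, ?_⟩
    · rw [← Fin.succ_last, Fin.cons_succ, hal]
    · refine Fin.cases ?_ fun j => ?_
      · exact hub'
      · rw [Fin.castSucc_succ, Fin.cons_succ, Fin.cons_succ]
        exact h4 j
    · refine Fin.cases ?_ fun j => ?_
      · rw [Fin.cons_succ, ha0]
        exact hbc'
      · rw [Fin.cons_succ, Fin.cons_succ]
        exact h5 j
    · refine Fin.cases ?_ fun j => ?_
      · exact hbmin
      · rw [Fin.castSucc_succ, Fin.cons_succ, Fin.cons_succ]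
        exact h6 j
    · refine Fin.cases ?_ fun j => ?_
      · rw [Fin.cons_succ, ha0]
        exact hcmin
      · rw [Fin.cons_succ, Fin.cons_succ]
        exact h7 j

lemma exists_cyclicDecomposition {n : ℕ} [NeZero n] (σ : Equiv.Perm (Fin n))
    {I : Finset (Fin n)} (h0 : I.Nonempty) (h1 : I ≠ Finset.univ) :
    ∃ ℓ, Nonempty (CyclicDecomposition σ I ℓ) := by
  classical
  set p : ℕ → Prop := fun t => σ (Fin.ofNat n t) ∈ I with hp
  have hpn : ∀ t, p (t + n) ↔ p t := fun t => by simp only [hp, ofNat_add_card]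
  obtain ⟨x, hx⟩ := h0
  obtain ⟨y, hy⟩ : ∃ y, y ∉ I := by
    by_contra! hcon
    exact h1 (Finset.eq_univ_iff_forall.2 hcon)
  have hpx : p (σ.symm x : ℕ) := by simpa [hp] using hx
  have hpy : ¬ p ((σ.symm y : ℕ) + n) := by rw [hpn]; simpa [hp] using hy
  -- Start the window at the first position outside I after one inside I: then it begins outside I
  -- and, by periodicity, ends inside I.
  have hex : ∃ t, (σ.symm x : ℕ) ≤ t ∧ ¬ p t :=
    ⟨_, by have := (σ.symm x).2; omega, hpy⟩
  obtain ⟨hxu, hu⟩ := Nat.find_spec hex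
  have humin : ∀ t, (σ.symm x : ℕ) ≤ t → t < Nat.find hex → p t := fun t h4 h5 => by
    by_contra h6
    exact Nat.find_min hex h5 ⟨h4, h6⟩
  set u := Nat.find hex
  have hxu' : (σ.symm x : ℕ) < u := lt_of_le_of_ne hxu fun h => hu (h ▸ hpx)
  have hlast : p (u + n - 1) := by
    rw [show u + n - 1 = (u - 1) + n by omega, hpn]
    exact humin _ (by omega) (by omega)
  obtain ⟨ℓ, a, b, ha0, hal, h4, h5, h6, h7⟩ := exists_runs p _ u (u + n) le_rfl (by omega)
    fun _ => ⟨hu, hlast⟩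
  refine ⟨ℓ, ⟨⟨a, b, h4, h5, by rw [hal, ha0], fun j => ?_, fun j => ?_⟩⟩⟩
  · rw [Finset.disjoint_left]
    intro z hz
    obtain ⟨t, ht1, ht2, rfl⟩ := mem_arc.1 hz
    exact h6 j t ht1 ht2
  · intro z hz
    obtain ⟨t, ht1, ht2, rfl⟩ := mem_arc.1 hz
    exact h7 j t ht1 ht2

/-! ### The translated blade -/

/-- The partial sums of `x - e_I` along the cyclic order `σ`. -/
def walk {n : ℕ} [NeZero n] (σ : Equiv.Perm (Fin n)) (I : Finset (Fin n)) (x : Fin n → ℝ) :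
    ℕ → ℝ :=
  cyclicSum fun i => (x - eVec I) (σ i)

lemma sum_sub_eVec {n : ℕ} {σ : Equiv.Perm (Fin n)} {I : Finset (Fin n)} {x : Fin n → ℝ}
    (hx : ∑ t, x t = (I.card : ℝ)) : ∑ i, (x - eVec I) (σ i) = 0 := by
  rw [Equiv.sum_comp σ (x - eVec I)]
  simp [Finset.sum_sub_distrib, hx, sum_eVec]

section walk

variable {n : ℕ} [NeZero n] {σ : Equiv.Perm (Fin n)} {I : Finset (Fin n)} {x : Fin n → ℝ}

lemma walk_congr (hx : ∑ t, x t = (I.card : ℝ)) {t u : ℕ} (h : Fin.ofNat n t = Fin.ofNat n u) :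
    walk σ I x t = walk σ I x u := by
  rw [walk, ← cyclicSum_mod (sum_sub_eVec hx), ← cyclicSum_mod (sum_sub_eVec hx) u]
  rw [ofNat_eq_ofNat] at h
  rw [h]

lemma walk_sub_walk {t u : ℕ} (h : t ≤ u) :
    walk σ I x u - walk σ I x t = ∑ i ∈ Finset.Ico t u, (x - eVec I) (σ (Fin.ofNat n i)) :=
  (Finset.sum_Ico_eq_sub _ h).symm

/-- For singleton blocks with decorations 0, the heights of x - e_I are the values of the walk. -/
lemma mem_translatedBlade_iff : x ∈ translatedBlade σ (eVec I) ↔ ∑ t, x t = (I.card : ℝ) ∧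
    ∃ t : Fin n, (∀ u : Fin n, walk σ I x t ≤ walk σ I x u) ∧
      ∃ u : Fin n, u ≠ t ∧ walk σ I x u = walk σ I x t := by
  have hosp : IsDecoratedOSP 0 (fun i : Fin n => ({σ i} : Finset (Fin n))) (fun _ => 0) :=
    { nonempty := fun j => by simp
      disjoint := fun i j hij => by simpa using hij
      cover := fun y => ⟨σ.symm y, by simp⟩
      sum_eq := by simp }
  have hheight : ∀ t : Fin n, height (fun i : Fin n => ({σ i} : Finset (Fin n))) (fun _ => 0) t
      (x - eVec I) = walk σ I x t := fun t => by
    simp [height, walk, blockExcess, cyclicSum, coordSum]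
  have hmem : x ∈ translatedBlade σ (eVec I) ↔ x - eVec I ∈ cyclicBlade σ := by
    constructor
    · rintro ⟨y, hy, rfl⟩
      simpa using hy
    · exact fun h => ⟨_, h, by simp⟩
  rw [hmem, cyclicBlade, hosp.mem_blade_iff]
  simp only [hheight]
  refine and_congr_left fun _ => ?_
  simp [Finset.sum_sub_distrib, sum_eVec, sub_eq_zero]

end walk

/-! ### The walk compared with the block heights -/

namespace CyclicDecomposition

variable {n : ℕ} [NeZero n] {σ : Equiv.Perm (Fin n)} {I : Finset (Fin n)} {ℓ : ℕ}
  (D : CyclicDecomposition σ I ℓ) {x : Fin n → ℝ}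

/-- The decoration |I_j| is the sum of e_I over S_j, so the excess of a block is the increment of
the walk across it. -/
lemma blockExcess_eq (j : Fin ℓ) :
    blockExcess D.S D.s x j = walk σ I x (D.a j.succ) - walk σ I x (D.a j.castSucc) := by
  have h1 := D.strictMono_a (Fin.castSucc_lt_succ (i := j))
  have h2 := D.a_le j.succ
  have h3 := D.a_zero_le j.castSucc
  rw [walk_sub_walk h1.le, ← sum_arc (σ := σ) (x - eVec I) (by omega), ← D.S_eq_arc]
  change _ = coordSum (x - eVec I) (D.S j)
  rw [coordSum_sub, coordSum_eVec, D.inter_S]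
  simp [blockExcess, s]

lemma height_eq [NeZero ℓ] (j : Fin ℓ) :
    height D.S D.s j x = walk σ I x (D.a j.castSucc) - walk σ I x (D.a 0) := by
  have key : ∀ (t : ℕ) (ht : t < ℓ + 1), cyclicSum (blockExcess D.S D.s x) t =
      walk σ I x (D.a ⟨t, ht⟩) - walk σ I x (D.a 0) := by
    intro t
    induction t with
    | zero => intro ht; simp [cyclicSum]
    | succ t ih =>
      intro ht
      have hof : Fin.ofNat ℓ t = ⟨t, by omega⟩ := by
        ext; simpa using Nat.mod_eq_of_lt (by omega)
      rw [cyclicSum_succ, ih (by omega), hof, D.blockExcess_eq]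
      simp only [Fin.succ_mk, Fin.castSucc_mk]
      ring
  exact key j _

lemma walk_a_le_of_le_b (hx : x ∈ hypersimplex I.card n) {j : Fin ℓ} {t : ℕ}
    (h1 : D.a j.castSucc ≤ t) (h2 : t ≤ D.b j) : walk σ I x (D.a j.castSucc) ≤ walk σ I x t := by
  rw [← sub_nonneg, walk_sub_walk h1]
  refine Finset.sum_nonneg fun u hu => ?_
  rw [Finset.mem_Ico] at hu
  have := Finset.disjoint_left.1 (D.compl_run j) (mem_arc.2 ⟨u, hu.1, by omega, rfl⟩)
  rw [Pi.sub_apply, eVec_apply, if_neg this, sub_zero]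
  exact (hx.1 _).1

lemma walk_a_lt_of_le_b (hx : x ∈ openHypersimplex I.card n) {j : Fin ℓ} {t : ℕ}
    (h1 : D.a j.castSucc < t) (h2 : t ≤ D.b j) : walk σ I x (D.a j.castSucc) < walk σ I x t := by
  rw [← sub_pos, walk_sub_walk h1.le]
  refine Finset.sum_pos (fun u hu => ?_) ⟨_, Finset.mem_Ico.2 ⟨le_rfl, h1⟩⟩
  rw [Finset.mem_Ico] at hu
  have := Finset.disjoint_left.1 (D.compl_run j) (mem_arc.2 ⟨u, hu.1, by omega, rfl⟩)
  rw [Pi.sub_apply, eVec_apply, if_neg this, sub_zero]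
  exact (hx.1 _).1

lemma walk_a_le_of_b_le (hx : x ∈ hypersimplex I.card n) {j : Fin ℓ} {t : ℕ}
    (h1 : D.b j ≤ t) (h2 : t ≤ D.a j.succ) : walk σ I x (D.a j.succ) ≤ walk σ I x t := by
  rw [← sub_nonpos, walk_sub_walk h2]
  refine Finset.sum_nonpos fun u hu => ?_
  rw [Finset.mem_Ico] at hu
  have := D.run j (mem_arc.2 ⟨u, by omega, hu.2, rfl⟩)
  rw [Pi.sub_apply, eVec_apply, if_pos this, sub_nonpos]
  exact (hx.1 _).2

lemma walk_a_lt_of_b_le (hx : x ∈ openHypersimplex I.card n) {j : Fin ℓ} {t : ℕ}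
    (h1 : D.b j ≤ t) (h2 : t < D.a j.succ) : walk σ I x (D.a j.succ) < walk σ I x t := by
  rw [← sub_pos, ← neg_sub, walk_sub_walk h2.le, ← Finset.sum_neg_distrib]
  refine Finset.sum_pos (fun u hu => ?_) ⟨_, Finset.mem_Ico.2 ⟨le_rfl, h2⟩⟩
  rw [Finset.mem_Ico] at hu
  have := D.run j (mem_arc.2 ⟨u, by omega, hu.2, rfl⟩)
  rw [Pi.sub_apply, eVec_apply, if_pos this, neg_sub, sub_pos]
  exact (hx.1 _).2

/-- From a position in C_j walk back to the start of the block, from one in I_j walk on to the next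
start; neither goes up. -/
lemma exists_walk_a_le (hx : x ∈ hypersimplex I.card n) (t : ℕ) :
    ∃ j : Fin ℓ, walk σ I x (D.a j.castSucc) ≤ walk σ I x t := by
  obtain ⟨j, u, hu, h1, h2⟩ := D.locate t
  rw [← walk_congr hx.2 hu]
  rcases le_total u (D.b j) with h | h
  · exact ⟨j, D.walk_a_le_of_le_b hx h1 h⟩
  · obtain ⟨i, hi⟩ := D.exists_castSucc_ofNat_eq j.succ
    exact ⟨i, walk_congr hx.2 hi ▸ D.walk_a_le_of_b_le hx h h2.le⟩

/-- In the interior, all minima of the walk are at the starts of the blocks. -/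
lemma exists_ofNat_a_eq_of_min (hx : x ∈ openHypersimplex I.card n) {t : ℕ}
    (ht : ∀ u : ℕ, walk σ I x t ≤ walk σ I x u) :
    ∃ j : Fin ℓ, Fin.ofNat n (D.a j.castSucc) = Fin.ofNat n t := by
  obtain ⟨j, u, hu, h1, h2⟩ := D.locate t
  rcases h1.eq_or_lt with h | h
  · exact ⟨j, h ▸ hu⟩
  · exfalso
    have hut := walk_congr (σ := σ) hx.2 hu
    rcases le_total u (D.b j) with h' | h'
    · have := D.walk_a_lt_of_le_b hx h h'
      have := ht (D.a j.castSucc)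
      linarith
    · have := D.walk_a_lt_of_b_le hx h' h2
      have := ht (D.a j.succ)
      linarith

lemma ofNat_a_injective : Function.Injective fun j : Fin ℓ => Fin.ofNat n (D.a j.castSucc) := by
  intro i j hij
  have hlt : ∀ j : Fin ℓ, D.a j.castSucc < D.a 0 + n := fun j =>
    (D.strictMono_a (Fin.castSucc_lt_succ (i := j))).trans_le (D.a_le _)
  have := eq_of_ofNat_eq (D.a_zero_le _) (hlt i) (D.a_zero_le _) (hlt j) hij
  exact Fin.castSucc_injective _ (D.strictMono_a.injective this)

lemma mem_blade_iff : x ∈ blade (I.card : ℤ) D.S D.s ↔ ∑ t, x t = (I.card : ℝ) ∧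
    ∃ j : Fin ℓ, (∀ m : Fin ℓ, walk σ I x (D.a j.castSucc) ≤ walk σ I x (D.a m.castSucc)) ∧
      ∃ m : Fin ℓ, m ≠ j ∧ walk σ I x (D.a m.castSucc) = walk σ I x (D.a j.castSucc) := by
  have : NeZero ℓ := ⟨D.pos.ne'⟩
  rw [D.isHypersimplicialOSP.mem_blade_iff]
  simp only [D.height_eq, sub_le_sub_iff_right, sub_left_inj, Int.cast_natCast]

/-- A minimum over the block starts is a minimum of the whole walk, and distinct blocks start at
distinct residues. -/
lemma blade_inter_subset : blade (I.card : ℤ) D.S D.s ∩ hypersimplex I.card n ⊆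
    translatedBlade σ (eVec I) ∩ hypersimplex I.card n := by
  rintro x ⟨hb, hx⟩
  refine ⟨?_, hx⟩
  obtain ⟨hk, j, hj, m, hmj, hm⟩ := D.mem_blade_iff.1 hb
  have hval : ∀ t, walk σ I x (Fin.ofNat n t : Fin n) = walk σ I x t := fun t =>
    walk_congr hk (ofNat_eq_ofNat.2 (Nat.mod_modEq t n))
  refine mem_translatedBlade_iff.2 ⟨hk, Fin.ofNat n (D.a j.castSucc), fun u => ?_,
    Fin.ofNat n (D.a m.castSucc), fun h => hmj (D.ofNat_a_injective h), by rw [hval, hval, hm]⟩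
  obtain ⟨i, hi⟩ := D.exists_walk_a_le hx u
  rw [hval]
  exact (hj i).trans hi

lemma translatedBlade_inter_openHypersimplex :
    translatedBlade σ (eVec I) ∩ openHypersimplex I.card n =
      blade (I.card : ℤ) D.S D.s ∩ openHypersimplex I.card n := by
  ext x
  refine ⟨?_, fun ⟨hb, hx⟩ =>
    ⟨(D.blade_inter_subset ⟨hb, openHypersimplex_subset _ _ hx⟩).1, hx⟩⟩
  rintro ⟨hb, hx⟩
  refine ⟨?_, hx⟩
  obtain ⟨hk, t, ht, u, hut, hu⟩ := mem_translatedBlade_iff.1 hb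
  have hval : ∀ t, walk σ I x (Fin.ofNat n t : Fin n) = walk σ I x t := fun t =>
    walk_congr hk (ofNat_eq_ofNat.2 (Nat.mod_modEq t n))
  have ht' : ∀ v : ℕ, walk σ I x t ≤ walk σ I x v := fun v => hval v ▸ ht (Fin.ofNat n v)
  obtain ⟨j, hj⟩ := D.exists_ofNat_a_eq_of_min hx ht'
  obtain ⟨m, hm⟩ := D.exists_ofNat_a_eq_of_min hx (t := u) (by rwa [hu])
  refine D.mem_blade_iff.2 ⟨hk, j, fun i => ?_, m, ?_, ?_⟩
  · rw [walk_congr hk hj]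
    exact ht' _
  · rintro rfl
    rw [hj] at hm
    exact hut (by simpa using hm.symm)
  · rw [walk_congr hk hj, walk_congr hk hm, hu]

end CyclicDecomposition

/-! ### The main theorem -/

theorem mainTheorem2 {n k : ℕ} [NeZero n] (hk : 1 ≤ k) (hkn : k ≤ n - 1)
    (σ : Equiv.Perm (Fin n)) (I : Finset (Fin n)) (hI : I.card = k) :
    (∃ ℓ : ℕ, Nonempty (CyclicDecomposition σ I ℓ)) ∧
    ∀ (ℓ : ℕ) (D : CyclicDecomposition σ I ℓ),
      ℓ = numCyclicIntervals σ I ∧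
      IsHypersimplicialOSP (k : ℤ) D.S D.s ∧
      translatedBlade σ (eVec I) ∩ intrinsicInterior ℝ (hypersimplex k n) =
        blade (k : ℤ) D.S D.s ∩ intrinsicInterior ℝ (hypersimplex k n) ∧
      blade (k : ℤ) D.S D.s ∩ hypersimplex k n ⊆
        translatedBlade σ (eVec I) ∩ hypersimplex k n ∧
      IsSplit ℓ (hypersimplex k n)
        (inducedCells (hypersimplex k n) (translatedBlade σ (eVec I))) ∧
      (∀ Q ∈ inducedCells (hypersimplex k n) (translatedBlade σ (eVec I)),
        IsMatroidPolytope Q) ∧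
      (inducedCells (hypersimplex k n) (translatedBlade σ (eVec I)) = {hypersimplex k n} ↔
        IsCyclicInterval σ I) := by
  subst hI
  refine ⟨exists_cyclicDecomposition σ (Finset.card_pos.1 hk) fun h => ?_, fun ℓ D => ?_⟩
  · rw [h, Finset.card_univ, Fintype.card_fin] at hk hkn
    omega
  have : NeZero ℓ := ⟨D.pos.ne'⟩
  have hosp := D.isHypersimplicialOSP
  have hblade : translatedBlade σ (eVec I) ∩ intrinsicInterior ℝ (hypersimplex I.card n) =
      blade (I.card : ℤ) D.S D.s ∩ intrinsicInterior ℝ (hypersimplex I.card n) := by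
    rw [intrinsicInterior_hypersimplex hosp.openHypersimplex_nonempty]
    exact D.translatedBlade_inter_openHypersimplex
  have hcells := hosp.inducedCells_eq hblade
  refine ⟨D.numCyclicIntervals_eq.symm, hosp, hblade, D.blade_inter_subset, ?_, ?_, ?_⟩
  · rw [hcells]
    exact hosp.isSplit
  · rw [hcells]
    rintro _ ⟨j, rfl⟩
    exact hosp.isMatroidPolytope_cell j
  · rw [hcells, D.isCyclicInterval_iff]
    have hcard := hosp.ncard_range_cell
    constructor
    · intro h
      rw [← hcard, h, ncard_singleton]
    · intro h
      obtain ⟨Q, hQ⟩ := ncard_eq_one.1 (hcard.trans h)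
      have hcover := hosp.isSubdivision.cover
      rw [hQ, sUnion_singleton] at hcover
      rw [hQ, hcover]
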